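/- Let $\mathcal X(t)$, $t\ge 0$, be a continuous-time Markov chain with finite state space $\{1,\dots,\mathcal S\}$ and infinitesimal generator $\mathbf Q$. For each block length $N\ge 1$, consider a channel whose state sequence is the sampled chain $S_n=\mathcal X(n/N)$, $n=0,\dots,N$, so that the states change rarely when $N$ is large. The $n$-th use of the channel is a binary symmetric channel with crossover probability $\varepsilon_{S_{n-1}}$, where $0\le\varepsilon_1<\dots<\varepsilon_{\mathcal S}\le\frac12$; given the states, the uses are independent of each other, and the states do not depend on the inputs. A random code of rate $R$ (in nats) with $M=e^{NR}$ codewords of length $N$ (rounded down or up to an integer) is used, all symbols of all codewords being independent and uniform on the two inputs. The receiver knows the channel states and uses maximum-likelihood decoding, with ties resolved in any way or counted as failures. Let $P_{\mathrm e,S_N|S_0}(j|i)$ be the probability, averaged over the random code, that a given transmitted message is decoded erroneously and $S_N=j$, conditioned on $S_0=i$ (where $\Pr(S_0=i)>0$). Fix $\rho\in[0,1]$ and set $$b_s(\rho)=-\ln\Big[\frac1{2^\rho}\Big(\varepsilon_s^{\frac1{1+\rho}}+(1-\varepsilon_s)^{\frac1{1+\rho}}\Big)^{1+\rho}\Big],\qquad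 W(\rho)=\sum_{s=1}^{\mathcal S} b_s(\rho)\int_0^1\mathbf 1_{\{\mathcal X(t)=s\}}\,dt ,$$ and let $W_N(\rho)$ be defined like $W(\rho)$ with $\mathcal X(t)$ replaced by $\mathcal X_N(t)=\mathcal X(\lfloor Nt\rfloor/N)$. Let $G_{j|i}$ and $G_{N,j|i}$ be the measures on $\mathbb R$ given by $$G_{j|i}(B)=\Pr(W(\rho)\in B,\ \mathcal X(1)=j\mid \mathcal X(0)=i),\qquad G_{N,j|i}(B)=\Pr(W_N(\rho)\in B,\ \mathcal X(1)=j\mid \mathcal X(0)=i),$$ and let $g_N(w)=\min\{1,e^{-N(w-\rho R)}\}$. All integrals below are over $w\in[b_{\mathcal S}(\rho),b_1(\rho)]$. Then: 1. for every $N\ge1$, $\displaystyle P_{\mathrm e,S_N|S_0}(j|i)\le\int g_N\,dG_{N,j|i}$; 2. $\displaystyle\lim_{N\to\infty}\int g_N\,dG_{N,j|i}=\int \mathbf 1_{(-\infty,\rho R]}\,dG_{j|i}$; 3. $\displaystyle\lim_{N\to\infty}\int g_N\,dG_{j|i}=\int \mathbf 1_{(-\infty,\rho R]}\,dG_{j|i}$.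 Consequently, $P_{\mathrm e,S_N|S_0}(j|i)\lesssim\int g_N\,dG_{j|i}$ in the following sense: for every $\delta>0$ there is an $N_0$ such that for all $N\ge N_0$, every such decoder and every transmitted message, $P_{\mathrm e,S_N|S_0}(j|i)\le\int g_N\,dG_{j|i}+\delta$. -/

import Mathlib

open MeasureTheory ProbabilityTheory Filter Topology
open scoped ENNReal NNReal BigOperators

noncomputable section

namespace RareTransition

/-! ### Continuous-time Markov chains on a finite state space -/

/-- `Q` is an infinitesimal generator: non-negative off-diagonal rates, rows summing to zero. -/
structure IsGenerator {ι : Type*} [Fintype ι] (Q : Matrix ι ι ℝ) : Prop where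
  rate_nonneg : ∀ i j, i ≠ j → 0 ≤ Q i j
  row_sum : ∀ i, ∑ j, Q i j = 0

/-- The rate `q i = -Q i i` at which state `i` is left. -/
def exitRate {ι : Type*} (Q : Matrix ι ι ℝ) (i : ι) : ℝ := -Q i i

/-- The transition matrix of the jump chain: `Q i j / q i` off the diagonal when `q i ≠ 0`;
a state with `q i = 0` is absorbing. -/
def jumpMatrix {ι : Type*} [DecidableEq ι] (Q : Matrix ι ι ℝ) (i j : ι) : ℝ :=
  if exitRate Q i = 0 then (if i = j then 1 else 0)
  else (if i = j then 0 else Q i j / exitRate Q i)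

/-- `Y` and `T` are the jump chain and the holding times of a chain with generator `Q`:
`Y` is a Markov chain with transition matrix `jumpMatrix Q` and, given the visited states, the
holding times are independent, the `k`-th one being exponential with parameter
`exitRate Q (Y k)` (equal to `∞` when this rate is zero). -/
structure IsJumpHolding {Ω ι : Type*} [MeasurableSpace Ω] [DecidableEq ι] [MeasurableSpace ι]
    (μ : Measure Ω) (Q : Matrix ι ι ℝ) (Y : ℕ → Ω → ι) (T : ℕ → Ω → ℝ≥0∞) : Prop where
  measurable_state : ∀ k, Measurable (Y k)
  measurable_hold : ∀ k, Measurable (T k)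
  law : ∀ (n : ℕ) (y : ℕ → ι) (r : ℕ → ℝ≥0),
    μ {ω | (∀ k ≤ n, Y k ω = y k) ∧ ∀ k < n, (r k : ℝ≥0∞) < T k ω} =
      μ {ω | Y 0 ω = y 0} *
        ∏ k ∈ Finset.range n,
          ENNReal.ofReal (jumpMatrix Q (y k) (y (k + 1)) * Real.exp (-(exitRate Q (y k) * r k)))

/-- `X` (at times `t ≥ 0`) is a continuous-time Markov chain with generator `Q` under `μ`, with
arbitrary initial law: almost surely, it sits in the `n`-th state of its jump chain from the
`n`-th jump time (the sum of the first `n` holding times) until just before the next one. -/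
structure IsCTMC {Ω ι : Type*} [MeasurableSpace Ω] [DecidableEq ι] [MeasurableSpace ι]
    (μ : Measure Ω) (Q : Matrix ι ι ℝ) (X : ℝ → Ω → ι) : Prop where
  measurable : ∀ t, 0 ≤ t → Measurable (X t)
  jump_holding : ∃ (Y : ℕ → Ω → ι) (T : ℕ → Ω → ℝ≥0∞), IsJumpHolding μ Q Y T ∧
    ∀ᵐ ω ∂μ, ∀ t : ℝ, 0 ≤ t → ∀ n : ℕ,
      ∑ k ∈ Finset.range n, T k ω ≤ ENNReal.ofReal t →
      ENNReal.ofReal t < ∑ k ∈ Finset.range (n + 1), T k ω → X t ω = Y n ω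

/-- The process sampled every `1 / N` units of time, `X_N(t) = X(⌊N t⌋ / N)`. -/
def sampled {Ω ι : Type*} (N : ℕ) (X : ℝ → Ω → ι) (t : ℝ) : Ω → ι :=
  X ((⌊(N : ℝ) * t⌋ : ℝ) / N)

/-- The time spent in state `i` during `[0, 1]`, along the outcome `ω`. -/
def occupationTime {Ω ι : Type*} [DecidableEq ι] (X : ℝ → Ω → ι) (i : ι) (ω : Ω) : ℝ :=
  ∫ t in (0 : ℝ)..1, if X t ω = i then 1 else 0

/-- The weighted occupation time `∑ i, η_i b_i`. -/
def weightedOccupation {Ω ι : Type*} [Fintype ι] [DecidableEq ι] (b : ι → ℝ) (X : ℝ → Ω → ι)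
    (ω : Ω) : ℝ :=
  ∑ i, occupationTime X i ω * b i

/-- The measure `B ↦ Pr(W ∈ B, X(1) = j | X(0) = i)`, with `W` the weighted occupation time
of `X`: the joint law of `W` and the final state, given the initial state. -/
def occupationLaw {Ω ι : Type*} [MeasurableSpace Ω] [Fintype ι] [DecidableEq ι]
    (μ : Measure Ω) (b : ι → ℝ) (X : ℝ → Ω → ι) (i j : ι) : Measure ℝ :=
  ((μ[|{ω | X 0 ω = i}]).restrict {ω | X 1 ω = j}).map (weightedOccupation b X)

/-! ### Random coding over a Gilbert-Elliott type channel -/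

/-- The exponent `b(ρ)` of a binary symmetric channel with crossover probability `e`. -/
def bscExponent (e ρ : ℝ) : ℝ :=
  -Real.log (1 / (2 : ℝ) ^ ρ * (e ^ (1 / (1 + ρ)) + (1 - e) ^ (1 / (1 + ρ))) ^ (1 + ρ))

/-- The probability that a binary symmetric channel with crossover probability `e` outputs `y`
on input `x`. -/
def bscProb (e : ℝ) (x y : Bool) : ℝ := if x = y then 1 - e else e

/-- The probability of receiving `y` when `x` is sent and the states are `s 0, …, s N`; the
`n`-th use of the channel (`n = 1, …, N`) is governed by the state `s (n - 1)`. -/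
def likelihood {ι : Type*} {N : ℕ} (ε : ι → ℝ) (s : Fin (N + 1) → ι) (x y : Fin N → Bool) : ℝ :=
  ∏ n : Fin N, bscProb (ε (s n.castSucc)) (x n) (y n)

/-- A code with `M` codewords of length `N`. -/
abbrev Codebook (M N : ℕ) : Type := Fin M → Fin N → Bool

/-- The probability of a codebook in the ensemble in which all symbols of all codewords are
drawn independently from the uniform distribution on the two input symbols. -/
def codebookProb {M N : ℕ} (c : Codebook M N) : ℝ :=
  ∏ k : Fin M, ∏ n : Fin N, (fun _ : Bool => (1 / 2 : ℝ)) (c k n)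

/-- A decoder that knows the states, the codebook and the channel output; `none` means that it
declares a failure. -/
abbrev Decoder (ι : Type*) (M N : ℕ) : Type _ :=
  (Fin (N + 1) → ι) → Codebook M N → (Fin N → Bool) → Option (Fin M)

/-- Message `l` maximizes the likelihood of the output `y`. -/
def IsMostLikely {ι : Type*} {M N : ℕ} (ε : ι → ℝ) (s : Fin (N + 1) → ι) (c : Codebook M N)
    (y : Fin N → Bool) (l : Fin M) : Prop :=
  ∀ k, likelihood ε s (c k) y ≤ likelihood ε s (c l) y

/-- Maximum-likelihood decoding. Ties may be resolved in any way, and they may also be declared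
as failures. -/
def IsMaximumLikelihood {ι : Type*} {M N : ℕ} (ε : ι → ℝ) (dec : Decoder ι M N) : Prop :=
  ∀ s c y, (∀ l, dec s c y = some l → IsMostLikely ε s c y l) ∧
    (dec s c y = none → ∃ k l, k ≠ l ∧ IsMostLikely ε s c y k ∧ IsMostLikely ε s c y l)

/-- The probability, over the random codebook and the channel noise, that message `k` is
decoded erroneously, given that it was sent and that the state sequence is `s`. -/
def errorGivenStates {ι : Type*} {M N : ℕ} (ε : ι → ℝ) (dec : Decoder ι M N) (k : Fin M)
    (s : Fin (N + 1) → ι) : ℝ :=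
  ∑ c : Codebook M N, codebookProb c *
    ∑ y : Fin N → Bool, likelihood ε s (c k) y * (if dec s c y = some k then 0 else 1)

/-- `P_{e, S_N | S_0}(j | i)`: the probability that message `k`, when sent, is decoded
erroneously and the final state is `S_N = j`, given `S_0 = i`; the channel states are the
samples `S_n = X(n / N)`. -/
def jointErrorProb {Ω ι : Type*} [MeasurableSpace Ω] [Fintype ι] [DecidableEq ι]
    (μ : Measure Ω) (X : ℝ → Ω → ι) (ε : ι → ℝ) {M N : ℕ} (dec : Decoder ι M N) (k : Fin M)
    (i j : ι) : ℝ :=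
  ∑ s : Fin (N + 1) → ι with s (Fin.last N) = j,
    (μ[|{ω | X 0 ω = i}]).real {ω | ∀ n : Fin (N + 1), X ((n : ℝ) / N) ω = s n} *
      errorGivenStates ε dec k s

/-- The function `w ↦ min {1, e^{-N (w - ρ R)}}`. -/
def boundFun (N : ℕ) (ρ R w : ℝ) : ℝ := min 1 (Real.exp (-(N * (w - ρ * R))))

end RareTransition

end

open RareTransition

namespace RareTransition

/-! ### The random-coding bound -/

section

/-! For a fixed state sequence the channel is memoryless, so Gallager's random-coding argument
applies with one `ρ` for all uses. It bounds the error by `(M - 1) ^ ρ * ∏ exp (-b (s n))`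
(`errorGivenStates_le_gallager`). Since `M - 1 ≤ exp (N R)` and the average of the `b (s n)` is the
weighted occupation time `W_N` of the sampled path (`weightedOccupation_sampled`), this and the
trivial bound 1 give `g_N(W_N)`. Averaging over the states yields the bound at every block length.

For the limit, almost every path makes finitely many jumps in `[0, 1]`, so `W_N → W`
(`IsCTMC.tendsto_weightedOccupation`). Hence `g_N(W_N)` tends to the indicator of `W ≤ ρ R`, except
possibly where `W = ρ R`: there the limit depends on how fast `W_N` approaches `W`. This case is
harmless. Given the visited states, `W` after at least one jump is affine in independent holding
times without finite atoms, and the last one has a nonzero coefficient, so `W = ρ R` has probability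
zero (`IsJumpHolding.cond_linear_eq_null`). On constant paths `W_N = W` exactly and `g_N = 1`
(`IsCTMC.ae_weightedOccupation_sampled_eq`). If `ρ = 0` all weights vanish and `W_N = W = 0`.
Dominated convergence concludes. With `G` in place of `G_N` the argument `w` does not move with `N`,
so pointwise convergence is immediate. -/

lemma sum_insertNth {A : Type*} [Fintype A] {m : ℕ} (k : Fin (m + 1))
    (F : (Fin (m + 1) → A) → ℝ) :
    ∑ c, F c = ∑ x : A, ∑ c : Fin m → A, F (k.insertNth x c) := by
  rw [← Fintype.sum_prod_type', ← (Fin.insertNthEquiv (fun _ => A) k).sum_comp]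
  rfl

lemma sum_prod_pi_eq_one {A κ : Type*} [Fintype A] [Fintype κ] [DecidableEq κ] (p : A → ℝ)
    (hp1 : ∑ x, p x = 1) : ∑ c : κ → A, ∏ l, p (c l) = 1 := by
  have := Finset.prod_univ_sum (fun _ : κ => (Finset.univ : Finset A)) (fun _ => p)
  rw [Fintype.piFinset_univ] at this
  rw [← this]; simp [hp1]

lemma sum_prod_mul_apply {A : Type*} [Fintype A] (p : A → ℝ)
    (hp1 : ∑ x, p x = 1) (h : A → ℝ) {m : ℕ} (l : Fin m) :
    ∑ c : Fin m → A, (∏ l, p (c l)) * h (c l) = ∑ x, p x * h x := by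
  obtain _ | m := m
  · exact l.elim0
  rw [sum_insertNth l]
  refine Finset.sum_congr rfl fun x _ => ?_
  simp only [Fin.prod_univ_succAbove _ l, Fin.insertNth_apply_same, Fin.insertNth_apply_succAbove]
  calc _ = p x * h x * ∑ c : Fin m → A, ∏ l, p (c l) := by
        rw [Finset.mul_sum]; exact Finset.sum_congr rfl fun c _ => by ring
    _ = _ := by rw [sum_prod_pi_eq_one p hp1, mul_one]

/-- The average over an ensemble of independent codewords of Gallager's bound. -/
lemma sum_gallager_le {A : Type*} [Fintype A] (p : A → ℝ) (hp0 : ∀ x, 0 ≤ p x)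
    (hp1 : ∑ x, p x = 1) (h : A → ℝ) (h0 : ∀ x, 0 ≤ h x) {m : ℕ} (k : Fin (m + 1)) {ρ : ℝ}
    (hρ0 : 0 ≤ ρ) (hρ1 : ρ ≤ 1) :
    ∑ c : Fin (m + 1) → A, (∏ l, p (c l)) * (h (c k) * (∑ l : Fin m, h (c (k.succAbove l))) ^ ρ)
      ≤ (m : ℝ) ^ ρ * (∑ x, p x * h x) ^ (1 + ρ) := by
  have hE : 0 ≤ ∑ x, p x * h x := Finset.sum_nonneg fun x _ => mul_nonneg (hp0 x) (h0 x)
  -- Jensen's inequality for `x ↦ x ^ ρ`, concave because `ρ ≤ 1`.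
  have jensen : ∑ c : Fin m → A, (∏ l, p (c l)) * (∑ l, h (c l)) ^ ρ
      ≤ (m * ∑ x, p x * h x) ^ ρ := by
    have := (Real.concaveOn_rpow hρ0 hρ1).le_map_sum (t := Finset.univ)
      (w := fun c : Fin m → A => ∏ l, p (c l)) (p := fun c => ∑ l, h (c l))
      (fun c _ => Finset.prod_nonneg fun l _ => hp0 _) (sum_prod_pi_eq_one p hp1)
      (fun c _ => Finset.sum_nonneg fun l _ => h0 _)
    simp only [smul_eq_mul] at this
    refine this.trans_eq ?_
    congr 1
    simp only [Finset.mul_sum]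
    rw [Finset.sum_comm]
    simp only [sum_prod_mul_apply p hp1 h]
    simp [Finset.mul_sum]
  -- The sent codeword is independent of its competitors, so the average factors.
  rw [sum_insertNth k]
  simp only [Fin.prod_univ_succAbove _ k, Fin.insertNth_apply_same, Fin.insertNth_apply_succAbove]
  calc _ = (∑ x, p x * h x) * ∑ c : Fin m → A, (∏ l, p (c l)) * (∑ l, h (c l)) ^ ρ := by
        rw [Finset.sum_mul]
        refine Finset.sum_congr rfl fun x _ => ?_
        rw [Finset.mul_sum]; exact Finset.sum_congr rfl fun c _ => by ring
    _ ≤ (∑ x, p x * h x) * (m * ∑ x, p x * h x) ^ ρ := by gcongr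
    _ = _ := by
        rw [Real.mul_rpow (by positivity) hE, Real.rpow_one_add' hE (by positivity)]; ring

lemma bscProb_nonneg {e : ℝ} (h0 : 0 ≤ e) (h1 : e ≤ 1) (x y : Bool) : 0 ≤ bscProb e x y := by
  unfold bscProb; split_ifs <;> linarith

variable {ι : Type*} {N : ℕ} {ε : ι → ℝ}

lemma likelihood_nonneg (h0 : ∀ s, 0 ≤ ε s) (h1 : ∀ s, ε s ≤ 1) (s : Fin (N + 1) → ι)
    (x y : Fin N → Bool) : 0 ≤ likelihood ε s x y :=
  Finset.prod_nonneg fun _ _ => bscProb_nonneg (h0 _) (h1 _) _ _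

lemma sum_prod_bool (f : Fin N → Bool → ℝ) :
    ∑ x : Fin N → Bool, ∏ n, f n (x n) = ∏ n, ∑ z, f n z := by
  rw [Finset.prod_univ_sum, Fintype.piFinset_univ]

lemma sum_likelihood (s : Fin (N + 1) → ι) (x : Fin N → Bool) :
    ∑ y, likelihood ε s x y = 1 := by
  unfold likelihood
  rw [sum_prod_bool (fun n z => bscProb (ε (s n.castSucc)) (x n) z)]
  refine Finset.prod_eq_one fun n _ => ?_
  cases x n <;> simp [bscProb]

/-- By the symmetry of the channel, flipping an output symbol only swaps the two terms of its
factor. The value is thus the same for all `y`, and the later sum over outputs is a multiplication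
by `2 ^ N`. -/
lemma sum_likelihood_rpow (h0 : ∀ s, 0 ≤ ε s) (h1 : ∀ s, ε s ≤ 1) (s : Fin (N + 1) → ι)
    (y : Fin N → Bool) (a : ℝ) :
    ∑ x : Fin N → Bool, (∏ _n : Fin N, (1 / 2 : ℝ)) * likelihood ε s x y ^ a
      = ∏ n : Fin N, (1 / 2 * (ε (s n.castSucc) ^ a + (1 - ε (s n.castSucc)) ^ a)) := by
  have : ∀ x : Fin N → Bool, (∏ _n : Fin N, (1 / 2 : ℝ)) * likelihood ε s x y ^ a
      = ∏ n, (1 / 2 * bscProb (ε (s n.castSucc)) (x n) (y n) ^ a) := fun x => by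
    rw [Finset.prod_mul_distrib, likelihood,
      Real.finsetProd_rpow _ _ fun n _ => bscProb_nonneg (h0 _) (h1 _) _ _]
  simp only [this]
  rw [sum_prod_bool (fun n z => 1 / 2 * bscProb (ε (s n.castSucc)) z (y n) ^ a)]
  refine Finset.prod_congr rfl fun n _ => ?_
  cases y n <;> simp [bscProb] <;> ring

lemma exp_neg_bscExponent {e : ℝ} (h0 : 0 ≤ e) (h1 : e < 1) (ρ : ℝ) :
    Real.exp (-bscExponent e ρ) =
      1 / (2 : ℝ) ^ ρ * (e ^ (1 / (1 + ρ)) + (1 - e) ^ (1 / (1 + ρ))) ^ (1 + ρ) := by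
  have : 0 < (1 - e) ^ (1 / (1 + ρ)) := Real.rpow_pos_of_pos (by linarith) _
  have : 0 ≤ e ^ (1 / (1 + ρ)) := Real.rpow_nonneg h0 _
  rw [bscExponent, neg_neg, Real.exp_log (by positivity)]

/-- A declared failure comes with two maximizers, at least one of which differs from `k`; a wrong
message is itself a maximizer. -/
lemma IsMaximumLikelihood.exists_le {M : ℕ} {dec : Decoder ι M N}
    (hdec : IsMaximumLikelihood ε dec) {k : Fin M} {s : Fin (N + 1) → ι} {c : Codebook M N}
    {y : Fin N → Bool} (h : dec s c y ≠ some k) :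
    ∃ l, l ≠ k ∧ likelihood ε s (c k) y ≤ likelihood ε s (c l) y := by
  obtain ⟨h1, h2⟩ := hdec s c y
  cases hd : dec s c y with
  | none =>
    obtain ⟨l, l', hl, hl1, hl2⟩ := h2 hd
    by_cases hk : l = k
    · exact ⟨l', fun h => hl (hk.trans h.symm), hl2 k⟩
    · exact ⟨l, hk, hl1 k⟩
  | some l => exact ⟨l, fun hk => h (hk ▸ hd), h1 l hd k⟩

/-- On an error some competitor is at least as likely as `k`, so the sum dominates the `1 / (1 + ρ)`
power of the likelihood of `k`; the exponents `1 / (1 + ρ)` and `ρ / (1 + ρ)` add up to one. -/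
lemma likelihood_mul_error_le (h0 : ∀ s, 0 ≤ ε s) (h1 : ∀ s, ε s ≤ 1) {m : ℕ}
    {dec : Decoder ι (m + 1) N} (hdec : IsMaximumLikelihood ε dec) (k : Fin (m + 1))
    (s : Fin (N + 1) → ι) (c : Codebook (m + 1) N) (y : Fin N → Bool) {ρ : ℝ} (hρ0 : 0 ≤ ρ) :
    likelihood ε s (c k) y * (if dec s c y = some k then 0 else 1) ≤
      likelihood ε s (c k) y ^ (1 / (1 + ρ)) *
        (∑ l : Fin m, likelihood ε s (c (k.succAbove l)) y ^ (1 / (1 + ρ))) ^ ρ := by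
  have hL : ∀ l, 0 ≤ likelihood ε s (c l) y := fun l => likelihood_nonneg h0 h1 s _ y
  have hLa : ∀ l, 0 ≤ likelihood ε s (c l) y ^ (1 / (1 + ρ)) := fun l => Real.rpow_nonneg (hL l) _
  have hR : 0 ≤ likelihood ε s (c k) y ^ (1 / (1 + ρ)) *
        (∑ l : Fin m, likelihood ε s (c (k.succAbove l)) y ^ (1 / (1 + ρ))) ^ ρ :=
    mul_nonneg (hLa k) (Real.rpow_nonneg (Finset.sum_nonneg fun l _ => hLa _) _)
  split_ifs with hd
  · simpa using hR
  obtain ⟨l, hlk, hl⟩ := hdec.exists_le hd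
  obtain ⟨l, rfl⟩ := Fin.exists_succAbove_eq hlk
  -- Adding exponents of real powers needs a positive base.
  rcases (hL k).eq_or_lt with h | h
  · rw [mul_one]; exact h.symm.le.trans hR
  calc likelihood ε s (c k) y * 1
      = likelihood ε s (c k) y ^ (1 / (1 + ρ)) *
          (likelihood ε s (c k) y ^ (1 / (1 + ρ))) ^ ρ := by
        rw [← Real.rpow_mul h.le, ← Real.rpow_add h, ← mul_one_add,
          one_div_mul_cancel (by positivity), Real.rpow_one, mul_one]
    _ ≤ _ := by
        refine mul_le_mul_of_nonneg_left (Real.rpow_le_rpow (hLa k) ?_ hρ0) (hLa k)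
        refine (Real.rpow_le_rpow h.le hl (by positivity)).trans ?_
        exact Finset.single_le_sum (f := fun l : Fin m =>
          likelihood ε s (c (k.succAbove l)) y ^ (1 / (1 + ρ))) (fun l _ => hLa _)
          (Finset.mem_univ l)

lemma prod_half_sum_eq_one : ∑ _x : Fin N → Bool, ∏ _n : Fin N, (1 / 2 : ℝ) = 1 := by
  rw [sum_prod_bool (fun _ _ => (1 / 2 : ℝ))]; simp

lemma errorGivenStates_le_one (h0 : ∀ s, 0 ≤ ε s) (h1 : ∀ s, ε s ≤ 1) {M : ℕ}
    (dec : Decoder ι M N) (k : Fin M) (s : Fin (N + 1) → ι) :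
    errorGivenStates ε dec k s ≤ 1 := by
  unfold errorGivenStates codebookProb
  calc _ ≤ ∑ c : Codebook M N, (∏ _k : Fin M, ∏ _n : Fin N, (1 / 2 : ℝ)) * 1 := by
        refine Finset.sum_le_sum fun c _ => mul_le_mul_of_nonneg_left ?_ (by positivity)
        refine (Finset.sum_le_sum fun y _ => ?_).trans (sum_likelihood (ε := ε) s (c k)).le
        refine mul_le_of_le_one_right (likelihood_nonneg h0 h1 _ _ _) ?_
        split_ifs <;> norm_num
    _ = 1 := by
        simp only [mul_one]
        exact sum_prod_pi_eq_one (κ := Fin M) (fun _ : Fin N → Bool => ∏ _n : Fin N, (1 / 2 : ℝ))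
          prod_half_sum_eq_one

lemma errorGivenStates_le_gallager (h0 : ∀ s, 0 ≤ ε s) (h1 : ∀ s, ε s < 1) {m : ℕ}
    {dec : Decoder ι (m + 1) N} (hdec : IsMaximumLikelihood ε dec) (k : Fin (m + 1))
    (s : Fin (N + 1) → ι) {ρ : ℝ} (hρ0 : 0 ≤ ρ) (hρ1 : ρ ≤ 1) :
    errorGivenStates ε dec k s ≤
      (m : ℝ) ^ ρ * ∏ n : Fin N, Real.exp (-bscExponent (ε (s n.castSucc)) ρ) := by
  have h1' : ∀ s, ε s ≤ 1 := fun s => (h1 s).le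
  unfold errorGivenStates codebookProb
  calc _ ≤ ∑ c : Codebook (m + 1) N, (∏ _k : Fin (m + 1), ∏ _n : Fin N, (1 / 2 : ℝ)) *
          ∑ y, likelihood ε s (c k) y ^ (1 / (1 + ρ)) *
            (∑ l : Fin m, likelihood ε s (c (k.succAbove l)) y ^ (1 / (1 + ρ))) ^ ρ := by
        refine Finset.sum_le_sum fun c _ => mul_le_mul_of_nonneg_left ?_ (by positivity)
        refine Finset.sum_le_sum fun y _ => ?_
        exact likelihood_mul_error_le h0 h1' hdec k s c y hρ0
    _ = ∑ y, ∑ c : Codebook (m + 1) N, (∏ _k : Fin (m + 1), ∏ _n : Fin N, (1 / 2 : ℝ)) *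
          (likelihood ε s (c k) y ^ (1 / (1 + ρ)) *
            (∑ l : Fin m, likelihood ε s (c (k.succAbove l)) y ^ (1 / (1 + ρ))) ^ ρ) := by
        simp only [Finset.mul_sum]; exact Finset.sum_comm
    _ ≤ ∑ y : Fin N → Bool, (m : ℝ) ^ ρ *
          (∏ n : Fin N, (1 / 2 * (ε (s n.castSucc) ^ (1 / (1 + ρ)) +
            (1 - ε (s n.castSucc)) ^ (1 / (1 + ρ))))) ^ (1 + ρ) := by
        refine Finset.sum_le_sum fun y _ => ?_
        rw [← sum_likelihood_rpow h0 h1' s y]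
        exact sum_gallager_le (fun _ : Fin N → Bool => ∏ _n : Fin N, (1 / 2 : ℝ))
          (fun _ => by positivity) prod_half_sum_eq_one
          (fun x => likelihood ε s x y ^ (1 / (1 + ρ)))
          (fun x => Real.rpow_nonneg (likelihood_nonneg h0 h1' _ _ _) _) k hρ0 hρ1
    _ = _ := by
        have hpos : ∀ n : Fin N, 0 ≤ ε (s n.castSucc) ^ (1 / (1 + ρ)) +
            (1 - ε (s n.castSucc)) ^ (1 / (1 + ρ)) := fun n =>
          add_nonneg (Real.rpow_nonneg (h0 _) _) (Real.rpow_nonneg (by linarith [h1' (s n.castSucc)]) _)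
        rw [← Real.finsetProd_rpow _ _ fun n _ => mul_nonneg (by norm_num) (hpos n)]
        simp only [exp_neg_bscExponent (h0 _) (h1 _)]
        rw [Finset.sum_const, Finset.card_univ, nsmul_eq_mul, mul_left_comm]
        congr 1
        -- One factor 2 per output symbol: `2 * (1 / 2) ^ (1 + ρ) = 1 / 2 ^ ρ` is the prefactor in
        -- `bscExponent`.
        have : ((Fintype.card (Fin N → Bool) : ℕ) : ℝ) = ∏ _n : Fin N, (2 : ℝ) := by simp
        rw [this, ← Finset.prod_mul_distrib]
        refine Finset.prod_congr rfl fun n _ => ?_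
        rw [Real.mul_rpow (by norm_num) (hpos n), ← mul_assoc]
        congr 1
        rw [Real.div_rpow (by norm_num) (by norm_num), Real.one_rpow,
          Real.rpow_one_add' (by norm_num) (by positivity)]
        field_simp

/-- The random-coding bound for a given state sequence. -/
lemma errorGivenStates_le_boundFun (h0 : ∀ s, 0 ≤ ε s) (h1 : ∀ s, ε s < 1) (hN : 1 ≤ N) {M : ℕ}
    {R : ℝ} (hM : (M : ℝ) < Real.exp (N * R) + 1)
    {dec : Decoder ι M N} (hdec : IsMaximumLikelihood ε dec) (k : Fin M)
    (s : Fin (N + 1) → ι) {ρ : ℝ} (hρ0 : 0 ≤ ρ) (hρ1 : ρ ≤ 1) :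
    errorGivenStates ε dec k s ≤
      boundFun N ρ R ((∑ n : Fin N, bscExponent (ε (s n.castSucc)) ρ) / N) := by
  obtain _ | m := M
  · exact k.elim0
  refine le_min (errorGivenStates_le_one h0 (fun s => (h1 s).le) dec k s)
    ((errorGivenStates_le_gallager h0 h1 hdec k s hρ0 hρ1).trans ?_)
  rw [← Real.exp_sum, Finset.sum_neg_distrib]
  have hN' : (N : ℝ) ≠ 0 := by positivity
  -- Only the `m = M - 1` competitors count, which is why rounding `exp (N R)` up is allowed.
  have hm : (m : ℝ) ≤ Real.exp (N * R) := by push_cast at hM; linarith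
  calc _ ≤ Real.exp (N * R) ^ ρ * Real.exp (-∑ n : Fin N, bscExponent (ε (s n.castSucc)) ρ) := by
        gcongr
    _ = _ := by
        rw [← Real.exp_mul, ← Real.exp_add]
        congr 1
        field_simp
        ring

end

/-! ### Monotonicity of the exponent -/

/-- Both `y` and `1 - y` are convex combinations of `x` and `1 - x`, with weights `1 - t`, `t`
interchanged. Adding the two strict concavity inequalities gives the claim. -/
lemma strictMonoOn_rpow_add_rpow {a : ℝ} (ha0 : 0 < a) (ha1 : a < 1) :
    StrictMonoOn (fun x : ℝ => x ^ a + (1 - x) ^ a) (Set.Icc 0 (1 / 2)) := by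
  rintro x ⟨hx0, hx⟩ y ⟨hy0, hy⟩ hxy
  have hd : 0 < 1 - 2 * x := by linarith
  set t := (y - x) / (1 - 2 * x) with ht
  have ht0 : 0 < t := div_pos (by linarith) hd
  have ht1 : t < 1 := (div_lt_one hd).2 (by linarith)
  have htd : t * (1 - 2 * x) = y - x := div_mul_cancel₀ _ hd.ne'
  have hc := (Real.strictConcaveOn_rpow ha0 ha1).2 (x := x) (y := 1 - x) hx0
    (show (0 : ℝ) ≤ 1 - x by linarith) (by intro h; linarith)
  have h1 := hc (a := 1 - t) (b := t) (by linarith) ht0 (by ring)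
  have h2 := hc (a := t) (b := 1 - t) ht0 (by linarith) (by ring)
  simp only [smul_eq_mul] at h1 h2
  rw [show (1 - t) * x + t * (1 - x) = y by linarith] at h1
  rw [show t * x + (1 - t) * (1 - x) = 1 - y by linarith] at h2
  simp only
  linarith

lemma strictAntiOn_bscExponent {ρ : ℝ} (hρ : 0 < ρ) :
    StrictAntiOn (fun e => bscExponent e ρ) (Set.Icc 0 (1 / 2)) := by
  intro x hx y hy hxy
  have h := strictMonoOn_rpow_add_rpow (a := 1 / (1 + ρ)) (by positivity)
    ((div_lt_one (by positivity)).2 (by linarith)) hx hy hxy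
  rw [← neg_lt_neg_iff, ← Real.exp_lt_exp,
    exp_neg_bscExponent hx.1 (by linarith [hx.2]), exp_neg_bscExponent hy.1 (by linarith [hy.2])]
  have : 0 ≤ x ^ (1 / (1 + ρ)) + (1 - x) ^ (1 / (1 + ρ)) :=
    add_nonneg (Real.rpow_nonneg hx.1 _) (Real.rpow_nonneg (by linarith [hx.2]) _)
  exact mul_lt_mul_of_pos_left (Real.rpow_lt_rpow this h (by positivity)) (by positivity)

lemma bscExponent_zero (e : ℝ) : bscExponent e 0 = 0 := by simp [bscExponent]

/-! ### Limits of the bounding functions -/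

lemma tendsto_boundFun_of_lt {ρ R w : ℝ} {u : ℕ → ℝ} (hu : Tendsto u atTop (𝓝 w))
    (h : w < ρ * R) : Tendsto (fun N => boundFun N ρ R (u N)) atTop (𝓝 1) := by
  refine tendsto_const_nhds.congr' ?_
  filter_upwards [hu.eventually_lt_const h] with N hN
  exact (min_eq_left (Real.one_le_exp (neg_nonneg.2
    (mul_nonpos_of_nonneg_of_nonpos (Nat.cast_nonneg _) (by linarith))))).symm

lemma tendsto_boundFun_of_gt {ρ R w : ℝ} {u : ℕ → ℝ} (hu : Tendsto u atTop (𝓝 w))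
    (h : ρ * R < w) : Tendsto (fun N => boundFun N ρ R (u N)) atTop (𝓝 0) := by
  have h1 : Tendsto (fun N : ℕ => Real.exp (-(N * (u N - ρ * R)))) atTop (𝓝 0) := by
    refine Real.tendsto_exp_neg_atTop_nhds_zero.comp ?_
    exact tendsto_natCast_atTop_atTop.atTop_mul_pos (sub_pos.2 h) (hu.sub_const _)
  exact squeeze_zero (fun N => le_min zero_le_one (Real.exp_pos _).le)
    (fun N => min_le_right _ _) h1

lemma boundFun_self (N : ℕ) (ρ R : ℝ) : boundFun N ρ R (ρ * R) = 1 := by simp [boundFun]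

lemma boundFun_nonneg (N : ℕ) (ρ R w : ℝ) : 0 ≤ boundFun N ρ R w :=
  le_min zero_le_one (Real.exp_pos _).le

lemma norm_boundFun_le (N : ℕ) (ρ R w : ℝ) : ‖boundFun N ρ R w‖ ≤ 1 := by
  rw [Real.norm_of_nonneg (boundFun_nonneg _ _ _ _)]; exact min_le_left _ _

lemma measurable_boundFun (N : ℕ) (ρ R : ℝ) : Measurable (boundFun N ρ R) := by
  unfold boundFun; fun_prop

/-- The bounding functions converge along a convergent sequence of arguments, provided that the
sequence is constant when its limit is the point of discontinuity. -/
lemma tendsto_boundFun {ρ R w : ℝ} {u : ℕ → ℝ} (hu : Tendsto u atTop (𝓝 w))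
    (h : w = ρ * R → ∀ᶠ N in atTop, u N = w) :
    Tendsto (fun N => boundFun N ρ R (u N)) atTop
      (𝓝 ((Set.Iic (ρ * R)).indicator (fun _ => (1 : ℝ)) w)) := by
  rcases lt_trichotomy w (ρ * R) with hw | hw | hw
  · rw [Set.indicator_of_mem (by exact hw.le)]
    exact tendsto_boundFun_of_lt hu hw
  · rw [Set.indicator_of_mem (by exact hw.le)]
    refine tendsto_const_nhds.congr' ?_
    filter_upwards [h hw] with N hN
    rw [hN, hw, boundFun_self]
  · rw [Set.indicator_of_notMem (by simpa using hw)]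
    exact tendsto_boundFun_of_gt hu hw

/-! ### Occupation times of step paths -/

lemma integral_step {g : ℝ → ℝ} {a : ℕ → ℝ} (ha : Monotone a) (c : ℕ → ℝ) (n : ℕ)
    (hg : ∀ k < n, ∀ t ∈ Set.Ioo (a k) (a (k + 1)), g t = c k) :
    IntervalIntegrable g volume (a 0) (a n) ∧
      ∫ t in a 0..a n, g t = ∑ k ∈ Finset.range n, (a (k + 1) - a k) * c k := by
  have hint : ∀ k < n, IntervalIntegrable g volume (a k) (a (k + 1)) := fun k hk =>
    (intervalIntegrable_const (c := c k)).congr_uIoo fun t ht => by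
      rw [Set.uIoo_of_le (ha k.le_succ)] at ht; exact (hg k hk t ht).symm
  refine ⟨IntervalIntegrable.trans_iterate hint, ?_⟩
  rw [← intervalIntegral.sum_integral_adjacent_intervals hint]
  refine Finset.sum_congr rfl fun k hk => ?_
  rw [intervalIntegral.integral_congr_Ioo_of_le (ha k.le_succ) (g := fun _ => c k)
    (fun t ht => hg k (Finset.mem_range.1 hk) t ht)]
  simp

/-- On `[0, 1]`, the path `x` has the value `y k` between the times `a k` and `a (k + 1)`. -/
structure IsStepPath {ι : Type*} (x : ℝ → ι) (y : ℕ → ι) (a : ℕ → ℝ) (n : ℕ) : Prop where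
  mono : Monotone a
  zero : a 0 = 0
  one : a n = 1
  eq : ∀ k < n, ∀ t ∈ Set.Ioo (a k) (a (k + 1)), x t = y k

section
variable {Ω ι : Type*}

lemma weightedOccupation_eq_sum [Fintype ι] [DecidableEq ι] (b : ι → ℝ) {X : ℝ → Ω → ι} {ω : Ω} {y : ℕ → ι} {a : ℕ → ℝ}
    {n : ℕ} (h : IsStepPath (fun t => X t ω) y a n) :
    weightedOccupation b X ω = ∑ k ∈ Finset.range n, (a (k + 1) - a k) * b (y k) := by
  have occ : ∀ i, occupationTime X i ω =
      ∑ k ∈ Finset.range n, (a (k + 1) - a k) * (if y k = i then 1 else 0) := fun i => by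
    have := (integral_step (g := fun t => if X t ω = i then 1 else 0) h.mono
      (fun k => if y k = i then 1 else 0) n
      (fun k hk t ht => by
        have hk : X t ω = y k := h.eq k hk t ht
        simp only [hk])).2
    rwa [h.zero, h.one] at this
  simp only [weightedOccupation, occ, Finset.sum_mul]
  rw [Finset.sum_comm]
  simp

/-! ### Sampled paths and their convergence -/

lemma floor_mul_eq {N k : ℕ} (hN : 1 ≤ N) {t : ℝ}
    (ht : t ∈ Set.Ico ((k : ℝ) / N) (((k + 1 : ℕ) : ℝ) / N)) : ⌊(N : ℝ) * t⌋ = k := by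
  have hN' : (0 : ℝ) < N := by exact_mod_cast hN
  obtain ⟨h1, h2⟩ := ht
  rw [div_le_iff₀' hN'] at h1
  rw [lt_div_iff₀' hN'] at h2
  push_cast at h2
  exact Int.floor_eq_iff.2 ⟨by exact_mod_cast h1, by exact_mod_cast h2⟩

lemma isStepPath_sampled (X : ℝ → Ω → ι) (ω : Ω) {N : ℕ} (hN : 1 ≤ N) :
    IsStepPath (fun t => sampled N X t ω) (fun k => X ((k : ℝ) / N) ω) (fun k => (k : ℝ) / N) N where
  mono k l hkl := by simp only; gcongr
  zero := by simp
  one := div_self (by positivity)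
  eq k _ t ht := by simp only [sampled, floor_mul_eq hN (Set.Ioo_subset_Ico_self ht), Int.cast_natCast]

lemma weightedOccupation_sampled [Fintype ι] [DecidableEq ι] (b : ι → ℝ) (X : ℝ → Ω → ι) (ω : Ω) {N : ℕ} (hN : 1 ≤ N) :
    weightedOccupation b (sampled N X) ω = (∑ n : Fin N, b (X ((n : ℝ) / N) ω)) / N := by
  rw [weightedOccupation_eq_sum b (isStepPath_sampled X ω hN), Finset.sum_div, Finset.sum_range]
  refine Finset.sum_congr rfl fun k _ => ?_
  push_cast
  ring

lemma tendsto_floor_mul_div (t : ℝ) :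
    Tendsto (fun N : ℕ => (⌊(N : ℝ) * t⌋ : ℝ) / N) atTop (𝓝 t) := by
  have h1 : Tendsto (fun N : ℕ => t - 1 / (N : ℝ)) atTop (𝓝 t) := by
    simpa using (tendsto_const_nhds (x := t)).sub (tendsto_const_div_atTop_nhds_zero_nat (1 : ℝ))
  refine tendsto_of_tendsto_of_tendsto_of_le_of_le' h1 tendsto_const_nhds ?_ ?_
  all_goals
    filter_upwards [eventually_ge_atTop 1] with N hN
    have hN' : (0 : ℝ) < N := by exact_mod_cast hN
  · rw [le_div_iff₀ hN', sub_mul, one_div_mul_cancel hN'.ne']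
    linarith [Int.sub_one_lt_floor ((N : ℝ) * t)]
  · rw [div_le_iff₀ hN']
    linarith [Int.floor_le ((N : ℝ) * t)]

lemma IsStepPath.exists_mem_Ioo {x : ℝ → ι} {y : ℕ → ι} {a : ℕ → ℝ}
    {n : ℕ} (h : IsStepPath x y a n) {t : ℝ} (ht : t ∈ Set.Ioc (0 : ℝ) 1)
    (hta : t ∉ Set.range a) : ∃ k < n, t ∈ Set.Ioo (a k) (a (k + 1)) := by
  classical
  have hex : ∃ k, t < a k :=
    ⟨n, lt_of_le_of_ne (h.one ▸ ht.2) fun h' => hta ⟨n, h'.symm⟩⟩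
  have hle : Nat.find hex ≤ n :=
    Nat.find_le (lt_of_le_of_ne (h.one ▸ ht.2) fun h' => hta ⟨n, h'.symm⟩)
  obtain ⟨k, hk⟩ : ∃ k, Nat.find hex = k + 1 := Nat.exists_eq_succ_of_ne_zero fun h0 => by
    have := Nat.find_spec hex; rw [h0, h.zero] at this; exact lt_asymm this ht.1
  refine ⟨k, by omega, lt_of_le_of_ne ?_ fun h' => hta ⟨k, h'⟩, hk ▸ Nat.find_spec hex⟩
  exact not_lt.1 (Nat.find_min hex (by omega))

/-- Off the countable set of division points, `⌊N t⌋ / N → t` eventually lies in the same open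
interval as `t`, so the integrands are eventually equal there. -/
lemma tendsto_weightedOccupation_sampled [Fintype ι] [DecidableEq ι] (b : ι → ℝ)
    {X : ℝ → Ω → ι} {ω : Ω} {y : ℕ → ι} {a : ℕ → ℝ} {n : ℕ} (h : IsStepPath (fun t => X t ω) y a n) :
    Tendsto (fun N => weightedOccupation b (sampled N X) ω) atTop
      (𝓝 (weightedOccupation b X ω)) := by
  refine tendsto_finsetSum _ fun i _ => Tendsto.mul_const _ ?_
  refine intervalIntegral.tendsto_integral_filter_of_dominated_convergence (fun _ => 1) ?_ ?_
    intervalIntegrable_const ?_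
  · refine Eventually.of_forall fun N => Measurable.aestronglyMeasurable ?_
    -- The path need not be measurable in `t`, but its sampled version factors through an integer.
    exact (measurable_from_top (f := fun z : ℤ => if X ((z : ℝ) / N) ω = i then (1 : ℝ) else 0)).comp
      (Int.measurable_floor.comp (measurable_const_mul (N : ℝ)))
  · refine Eventually.of_forall fun N => Eventually.of_forall fun t _ => ?_
    split_ifs <;> simp
  · filter_upwards [(Set.countable_range a).ae_notMem volume] with t hta ht
    rw [Set.uIoc_of_le zero_le_one] at ht
    obtain ⟨k, hk, htk⟩ := h.exists_mem_Ioo ht hta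
    refine tendsto_const_nhds.congr' ?_
    filter_upwards [(tendsto_floor_mul_div t).eventually_mem (isOpen_Ioo.mem_nhds htk)] with N hN
    have h1 : X ((⌊(N : ℝ) * t⌋ : ℝ) / N) ω = y k := h.eq k hk _ hN
    have h2 : X t ω = y k := h.eq k hk _ htk
    simp only [sampled, h1, h2]

lemma sampled_zero {X : ℝ → Ω → ι} (N : ℕ) : sampled N X 0 = X 0 := by simp [sampled]

lemma sampled_one {X : ℝ → Ω → ι} {N : ℕ} (hN : 1 ≤ N) : sampled N X 1 = X 1 := by
  have : (N : ℝ) ≠ 0 := by positivity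
  simp [sampled, this]

lemma weightedOccupation_sampled_mem [Fintype ι] [DecidableEq ι]
    {X : ℝ → Ω → ι} {b : ι → ℝ} {l u : ℝ}
    (hb : ∀ s, b s ∈ Set.Icc l u) (ω : Ω) {N : ℕ} (hN : 1 ≤ N) :
    weightedOccupation b (sampled N X) ω ∈ Set.Icc l u := by
  have hN' : (0 : ℝ) < N := by exact_mod_cast hN
  rw [weightedOccupation_sampled b X ω hN]
  constructor
  · rw [le_div_iff₀' hN']
    simpa using Finset.card_nsmul_le_sum Finset.univ (fun n : Fin N => b (X ((n : ℝ) / N) ω)) l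
      fun n _ => (hb _).1
  · rw [div_le_iff₀' hN']
    simpa using Finset.sum_le_card_nsmul Finset.univ (fun n : Fin N => b (X ((n : ℝ) / N) ω)) u
      fun n _ => (hb _).2

/-- The jump times, truncated at `1`, cut `[0, 1]` into intervals on which the path is constant. -/
lemma isStepPath_of_jump {x : ℝ → ι} {y : ℕ → ι} {T : ℕ → ℝ≥0∞}
    (h : ∀ t : ℝ, 0 ≤ t → ∀ n : ℕ, ∑ k ∈ Finset.range n, T k ≤ ENNReal.ofReal t →
      ENNReal.ofReal t < ∑ k ∈ Finset.range (n + 1), T k → x t = y n)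
    {n : ℕ} (hn : 1 ≤ ∑ k ∈ Finset.range n, T k) :
    IsStepPath x y (fun n => (min (∑ k ∈ Finset.range n, T k) 1).toReal) n where
  mono k l hkl := by
    refine ENNReal.toReal_mono (by simp) (min_le_min_right _ ?_)
    exact Finset.sum_le_sum_of_subset (Finset.range_mono hkl)
  zero := by simp
  one := by simp [hn]
  eq k hk t ht := by
    have h0 : 0 ≤ t := ENNReal.toReal_nonneg.trans ht.1.le
    have hlt : ENNReal.ofReal t < min (∑ k ∈ Finset.range (k + 1), T k) 1 := by
      rw [ENNReal.ofReal_lt_iff_lt_toReal h0 (by simp)]; exact ht.2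
    have hgt : min (∑ k ∈ Finset.range k, T k) 1 < ENNReal.ofReal t := by
      rw [ENNReal.lt_ofReal_iff_toReal_lt (by simp)]; exact ht.1
    refine h t h0 k ?_ (hlt.trans_le (min_le_left _ _))
    rcases min_lt_iff.1 hgt with h' | h'
    · exact h'.le
    · exact absurd (hlt.trans_le (min_le_right _ _)) h'.not_gt

end

/-! ### Jump chain and holding times -/

section
variable {ι : Type*} [Fintype ι] {Q : Matrix ι ι ℝ}

lemma IsGenerator.sum_erase [DecidableEq ι] (hQ : IsGenerator Q) (i : ι) :
    ∑ j ∈ Finset.univ.erase i, Q i j = exitRate Q i := by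
  have := hQ.row_sum i
  rw [← Finset.add_sum_erase _ _ (Finset.mem_univ i)] at this
  rw [exitRate]; linarith

lemma IsGenerator.exitRate_nonneg (hQ : IsGenerator Q) (i : ι) : 0 ≤ exitRate Q i := by
  classical
  rw [← hQ.sum_erase]
  exact Finset.sum_nonneg fun j hj => hQ.rate_nonneg i j (Finset.ne_of_mem_erase hj).symm

lemma IsGenerator.jumpMatrix_nonneg [DecidableEq ι] (hQ : IsGenerator Q) (i j : ι) :
    0 ≤ jumpMatrix Q i j := by
  unfold jumpMatrix
  split_ifs with h1 h2 h2
  any_goals norm_num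
  exact div_nonneg (hQ.rate_nonneg i j h2) (hQ.exitRate_nonneg i)

lemma IsGenerator.sum_jumpMatrix [DecidableEq ι] (hQ : IsGenerator Q) (i : ι) :
    ∑ j, jumpMatrix Q i j = 1 := by
  unfold jumpMatrix
  split_ifs with h
  · simp
  · rw [← Finset.add_sum_erase _ _ (Finset.mem_univ i), if_pos rfl, zero_add,
      ← div_self h, ← hQ.sum_erase, Finset.sum_div]
    exact Finset.sum_congr rfl fun j hj => if_neg (Finset.ne_of_mem_erase hj).symm

end

section
variable {Ω ι : Type*} [MeasurableSpace Ω] {μ : Measure Ω}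

/-- The event that the first `n + 1` states of the jump chain are those of `y`. -/
def pathEvent (Y : ℕ → Ω → ι) (n : ℕ) (y : ℕ → ι) : Set Ω := {ω | ∀ k ≤ n, Y k ω = y k}

lemma measurableSet_pathEvent [MeasurableSpace ι] [MeasurableSingletonClass ι] {Y : ℕ → Ω → ι}
    (hY : ∀ k, Measurable (Y k)) (n : ℕ) (y : ℕ → ι) : MeasurableSet (pathEvent Y n y) := by
  have : pathEvent Y n y = ⋂ k, ⋂ (_ : k ≤ n), Y k ⁻¹' {y k} := by ext; simp [pathEvent]
  rw [this]
  exact MeasurableSet.iInter fun k => MeasurableSet.iInter fun _ =>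
    hY k (measurableSet_singleton _)

/-- A bound that holds on every path event, relative to its probability, holds globally. -/
lemma measure_le_of_pathEvent [Fintype ι] [MeasurableSpace ι] [MeasurableSingletonClass ι]
    [IsProbabilityMeasure μ] {Y : ℕ → Ω → ι} (hY : ∀ k, Measurable (Y k)) (n : ℕ) (B : Set Ω)
    (δ : ℝ≥0∞) (h : ∀ y, μ (pathEvent Y n y ∩ B) ≤ δ * μ (pathEvent Y n y)) : μ B ≤ δ := by
  classical
  let f : Ω → Fin (n + 1) → ι := fun ω k => Y k ω
  -- A finite word is continued by repeating its last letter; only the first `n + 1` entries matter.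
  let ext : (Fin (n + 1) → ι) → ℕ → ι := fun w k => w ⟨min k n, by omega⟩
  have hE : ∀ w, pathEvent Y n (ext w) = f ⁻¹' {w} := fun w => by
    ext ω
    simp only [pathEvent, ext, f, Set.mem_ofPred_eq, Set.mem_preimage, Set.mem_singleton_iff,
      funext_iff]
    constructor
    · intro h k
      rw [h k (by omega)]; congr; omega
    · intro h k hk
      rw [← h]; simp [min_eq_left hk]
  calc μ B ≤ μ (⋃ w, pathEvent Y n (ext w) ∩ B) := by
        refine measure_mono fun ω hω => Set.mem_iUnion.2 ⟨f ω, ?_, hω⟩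
        rw [hE]; rfl
    _ ≤ ∑ w, μ (pathEvent Y n (ext w) ∩ B) := measure_iUnion_fintype_le _ _
    _ ≤ ∑ w, δ * μ (f ⁻¹' {w}) := Finset.sum_le_sum fun w _ => by rw [← hE]; exact h _
    _ ≤ δ * 1 := by
        rw [← Finset.mul_sum, sum_measure_preimage_singleton]
        · gcongr; exact prob_le_one
        · intro w _; rw [← hE]; exact measurableSet_pathEvent hY _ _
    _ = δ := mul_one _

namespace IsJumpHolding

variable [DecidableEq ι] [MeasurableSpace ι] {Q : Matrix ι ι ℝ} {Y : ℕ → Ω → ι}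
  {T : ℕ → Ω → ℝ≥0∞}

lemma measurableSet_pos (h : IsJumpHolding μ Q Y T) (n : ℕ) :
    MeasurableSet {ω | ∀ k < n, 0 < T k ω} := by
  have : {ω | ∀ k < n, 0 < T k ω} = ⋂ k, ⋂ (_ : k < n), T k ⁻¹' Set.Ioi 0 := by ext; simp
  rw [this]
  exact MeasurableSet.iInter fun k => MeasurableSet.iInter fun _ =>
    h.measurable_hold k measurableSet_Ioi

variable [Fintype ι]

lemma measure_pathEvent_inter (h : IsJumpHolding μ Q Y T) (hQ : IsGenerator Q) (n : ℕ)
    (y : ℕ → ι) (r : ℕ → ℝ≥0) :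
    μ (pathEvent Y n y ∩ {ω | ∀ k < n, (r k : ℝ≥0∞) < T k ω}) =
      μ {ω | Y 0 ω = y 0} * (∏ k ∈ Finset.range n, ENNReal.ofReal (jumpMatrix Q (y k) (y (k + 1)))) *
        ∏ k ∈ Finset.range n, ENNReal.ofReal (Real.exp (-(exitRate Q (y k) * r k))) := by
  rw [mul_assoc, ← Finset.prod_mul_distrib]
  simp only [← ENNReal.ofReal_mul (hQ.jumpMatrix_nonneg _ _)]
  exact h.law n y r

lemma measure_pathEvent_inter_pos (h : IsJumpHolding μ Q Y T) (hQ : IsGenerator Q) (n : ℕ)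
    (y : ℕ → ι) :
    μ (pathEvent Y n y ∩ {ω | ∀ k < n, 0 < T k ω}) =
      μ {ω | Y 0 ω = y 0} *
        ∏ k ∈ Finset.range n, ENNReal.ofReal (jumpMatrix Q (y k) (y (k + 1))) := by
  simpa using h.measure_pathEvent_inter hQ n y 0

variable [MeasurableSingletonClass ι]

/-- The holding times are almost surely positive. -/
lemma ae_pos [IsProbabilityMeasure μ] (h : IsJumpHolding μ Q Y T) (hQ : IsGenerator Q) :
    ∀ᵐ ω ∂μ, ∀ k, 0 < T k ω := by
  -- `law` controls `T n` only jointly with `Y (n + 1)`. Summing over this next state, the row sum 1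
  -- of `jumpMatrix` shows that requiring `0 < T n` as well costs no probability.
  have key : ∀ n, μ ({ω | ∀ k < n, 0 < T k ω} \ {ω | ∀ k < n + 1, 0 < T k ω}) = 0 := by
    intro n
    refine le_antisymm (measure_le_of_pathEvent h.measurable_state n _ 0 fun y => ?_) zero_le
    have hsub : {ω | ∀ k < n + 1, 0 < T k ω} ⊆ {ω | ∀ k < n, 0 < T k ω} :=
      fun ω hω k hk => hω k (by omega)
    rw [zero_mul, Set.inter_sdiff_distrib_left, measure_sdiff (Set.inter_subset_inter_right _ hsub)
      ((measurableSet_pathEvent h.measurable_state _ _).inter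
        (h.measurableSet_pos _)).nullMeasurableSet (measure_ne_top _ _)]
    refine (tsub_eq_zero_of_le ?_).le
    have hpre : pathEvent Y n y ∩ {ω | ∀ k < n + 1, 0 < T k ω} = ⋃ j : ι,
        pathEvent Y (n + 1) (Function.update y (n + 1) j) ∩ {ω | ∀ k < n + 1, 0 < T k ω} := by
      rw [← Set.iUnion_inter]
      congr 1
      ext ω
      simp only [pathEvent, Set.mem_ofPred_eq, Set.mem_iUnion]
      constructor
      · intro hω
        refine ⟨Y (n + 1) ω, fun k hk => ?_⟩
        rcases Nat.le_succ_iff.1 hk with hk | rfl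
        · rw [Function.update_of_ne (by omega), hω k hk]
        · rw [Function.update_self]
      · rintro ⟨j, hj⟩ k hk
        rw [hj k (by omega), Function.update_of_ne (by omega)]
    rw [hpre, measure_iUnion, tsum_fintype, h.measure_pathEvent_inter_pos hQ]
    · have : ∀ j, μ (pathEvent Y (n + 1) (Function.update y (n + 1) j) ∩
          {ω | ∀ k < n + 1, 0 < T k ω}) = μ {ω | Y 0 ω = y 0} *
          (∏ k ∈ Finset.range n, ENNReal.ofReal (jumpMatrix Q (y k) (y (k + 1)))) *
            ENNReal.ofReal (jumpMatrix Q (y n) j) := fun j => by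
        rw [h.measure_pathEvent_inter_pos hQ, Finset.prod_range_succ, ← mul_assoc]
        congr 2
        · refine Finset.prod_congr rfl fun k hk => ?_
          have := Finset.mem_range.1 hk
          rw [Function.update_of_ne (by omega), Function.update_of_ne (by omega)]
        · rw [Function.update_of_ne (by omega), Function.update_self]
      simp only [this]
      rw [← Finset.mul_sum, ← ENNReal.ofReal_sum_of_nonneg fun j _ => hQ.jumpMatrix_nonneg _ _,
        hQ.sum_jumpMatrix, ENNReal.ofReal_one, mul_one]
    · intro j j' hj
      refine Set.disjoint_left.2 fun ω hω hω' => hj ?_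
      have h1 := hω.1 (n + 1) le_rfl
      have h2 := hω'.1 (n + 1) le_rfl
      rw [Function.update_self] at h1 h2
      exact h1.symm.trans h2
    · intro j
      exact (measurableSet_pathEvent h.measurable_state _ _).inter (h.measurableSet_pos _)
  have key' : ∀ᵐ ω ∂μ, ∀ n, ω ∉ {ω | ∀ k < n, 0 < T k ω} \ {ω | ∀ k < n + 1, 0 < T k ω} :=
    ae_all_iff.2 fun n => measure_eq_zero_iff_ae_notMem.1 (key n)
  filter_upwards [key'] with ω hω
  have : ∀ n, ∀ k < n, 0 < T k ω := fun n => by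
    induction n with
    | zero => intro k hk; omega
    | succ n ih => by_contra hn; exact hω n ⟨ih, hn⟩
  exact fun k => this (k + 1) k k.lt_succ_self

lemma measure_pathEvent [IsProbabilityMeasure μ] (h : IsJumpHolding μ Q Y T) (hQ : IsGenerator Q)
    (n : ℕ) (y : ℕ → ι) :
    μ (pathEvent Y n y) = μ {ω | Y 0 ω = y 0} *
        ∏ k ∈ Finset.range n, ENNReal.ofReal (jumpMatrix Q (y k) (y (k + 1))) := by
  rw [← h.measure_pathEvent_inter_pos hQ]
  refine measure_congr ?_
  filter_upwards [h.ae_pos hQ] with ω hω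
  refine propext ⟨fun hE => ⟨hE, fun k _ => hω k⟩, fun hE => hE.1⟩

lemma cond_pathEvent_inter [IsProbabilityMeasure μ] (h : IsJumpHolding μ Q Y T)
    (hQ : IsGenerator Q) {n : ℕ} {y : ℕ → ι} (hE : μ (pathEvent Y n y) ≠ 0)
    (s : Finset (Fin n)) (r : Fin n → ℝ≥0) :
    μ[|pathEvent Y n y] (⋂ k ∈ s, T k ⁻¹' Set.Ioi (r k : ℝ≥0∞)) =
      ∏ k ∈ s, ENNReal.ofReal (Real.exp (-(exitRate Q (y k) * r k))) := by
  classical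
  -- Threshold 0 off `s` imposes nothing, as the holding times are almost surely positive.
  let r' : ℕ → ℝ≥0 := fun k => if hk : k < n then (if ⟨k, hk⟩ ∈ s then r ⟨k, hk⟩ else 0) else 0
  have hr' : ∀ k : Fin n, r' k = if k ∈ s then r k else 0 := fun k => by simp [r']
  have h1 := h.measure_pathEvent_inter hQ n y r'
  rw [← h.measure_pathEvent hQ] at h1
  rw [cond_apply (measurableSet_pathEvent h.measurable_state _ _)]
  have h2 : μ (pathEvent Y n y ∩ ⋂ k ∈ s, T k ⁻¹' Set.Ioi (r k : ℝ≥0∞)) =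
      μ (pathEvent Y n y ∩ {ω | ∀ k < n, (r' k : ℝ≥0∞) < T k ω}) := by
    refine measure_congr ?_
    filter_upwards [h.ae_pos hQ] with ω hω
    refine propext (and_congr_right fun _ => ?_)
    change (ω ∈ ⋂ k ∈ s, T k ⁻¹' Set.Ioi (r k : ℝ≥0∞)) ↔ ∀ k < n, (r' k : ℝ≥0∞) < T k ω
    simp only [Set.mem_iInter, Set.mem_preimage, Set.mem_Ioi]
    constructor
    · intro hs k hk
      have := hr' ⟨k, hk⟩
      simp only at this
      rw [this]
      split_ifs with hks
      · exact hs _ hks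
      · exact_mod_cast hω k
    · intro hs k hks
      have := hs k k.2
      rwa [hr', if_pos hks] at this
  rw [h2, h1, ← mul_assoc, ENNReal.inv_mul_cancel hE (measure_ne_top _ _), one_mul,
    Finset.prod_range]
  simp only [hr']
  rw [← Finset.prod_subset (Finset.subset_univ s)]
  · exact Finset.prod_congr rfl fun k hk => by rw [if_pos hk]
  · intro k _ hk; simp [hk]

/-- Given the visited states, the holding times have exponential tails. -/
lemma cond_tail [IsProbabilityMeasure μ] (h : IsJumpHolding μ Q Y T)
    (hQ : IsGenerator Q) {n : ℕ} {y : ℕ → ι} (hE : μ (pathEvent Y n y) ≠ 0) (k : Fin n) (r : ℝ≥0) :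
    μ[|pathEvent Y n y] (T k ⁻¹' Set.Ioi (r : ℝ≥0∞)) =
      ENNReal.ofReal (Real.exp (-(exitRate Q (y k) * r))) := by
  simpa using h.cond_pathEvent_inter hQ hE {k} (fun _ => r)

/-- Given the visited states, the holding times are independent. -/
lemma cond_iIndepFun [IsProbabilityMeasure μ] (h : IsJumpHolding μ Q Y T)
    (hQ : IsGenerator Q) {n : ℕ} {y : ℕ → ι} (hE : μ (pathEvent Y n y) ≠ 0) :
    iIndepFun (fun k : Fin n => T k) (μ[|pathEvent Y n y]) := by
  -- Half-lines form a π-system generating the Borel sets, so the product formula for tails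
  -- suffices.
  refine iIndepSets.iIndep (m := fun k : Fin n => MeasurableSpace.comap (T k) inferInstance)
    (fun k => (h.measurable_hold k).comap_le)
    (fun k => {s | ∃ t ∈ Set.range Set.Ioi, T k ⁻¹' t = s})
    (fun k => isPiSystem_Ioi.comap (T k)) (fun k => ?_) ?_
  · rw [BorelSpace.measurable_eq (α := ℝ≥0∞), borel_eq_generateFrom_Ioi,
      MeasurableSpace.comap_generateFrom]
    rfl
  · rw [iIndepSets_iff]
    intro s f hf
    have hf' : ∀ k : Fin n, ∃ a : ℝ≥0∞, k ∈ s → T k ⁻¹' Set.Ioi a = f k := fun k => by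
      by_cases hk : k ∈ s
      · obtain ⟨_, ⟨a, rfl⟩, ha⟩ := hf k hk; exact ⟨a, fun _ => ha⟩
      · exact ⟨0, fun h => absurd h hk⟩
    choose a ha using hf'
    -- The tail formula has finite thresholds only; with an infinite one both sides vanish.
    by_cases htop : ∃ k ∈ s, a k = ⊤
    · obtain ⟨k, hk, hkt⟩ := htop
      have hfk : f k = ∅ := by rw [← ha k hk, hkt]; simp
      rw [Finset.prod_eq_zero hk (by rw [hfk, measure_empty])]
      refine measure_mono_null (Set.iInter₂_subset k hk) (by rw [hfk, measure_empty])
    · push Not at htop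
      have hfa : ∀ k ∈ s, f k = T k ⁻¹' Set.Ioi (((a k).toNNReal : ℝ≥0) : ℝ≥0∞) := fun k hk => by
        rw [ENNReal.coe_toNNReal (htop k hk), ha k hk]
      rw [Set.iInter₂_congr hfa, h.cond_pathEvent_inter hQ hE]
      refine Finset.prod_congr rfl fun k hk => ?_
      rw [hfa k hk, h.cond_tail hQ hE]

lemma cond_ae_pos [IsProbabilityMeasure μ] (h : IsJumpHolding μ Q Y T) (hQ : IsGenerator Q)
    (E : Set Ω) : ∀ᵐ ω ∂μ[|E], ∀ k, 0 < T k ω :=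
  (cond_absolutelyContinuous).ae_le (h.ae_pos hQ)

/-- Given the visited states, the holding times have no finite atoms. -/
lemma cond_singleton [IsProbabilityMeasure μ] (h : IsJumpHolding μ Q Y T)
    (hQ : IsGenerator Q) {n : ℕ} {y : ℕ → ι} (hE : μ (pathEvent Y n y) ≠ 0) (k : Fin n) (t : ℝ≥0) :
    μ[|pathEvent Y n y] (T k ⁻¹' {(t : ℝ≥0∞)}) = 0 := by
  have : IsProbabilityMeasure (μ[|pathEvent Y n y]) := cond_isProbabilityMeasure hE
  rcases eq_or_ne t 0 with rfl | ht
  · refine measure_mono_null ?_ (ae_iff.1 (h.cond_ae_pos hQ (pathEvent Y n y)))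
    intro ω hω hpos
    exact (hpos k).ne' hω
  set q := exitRate Q (y k)
  -- The atom at `t` and the tail beyond `t` fit in the tail beyond `r`. Letting `r` increase to
  -- `t`, continuity of the tail leaves no mass for the atom.
  have hbound : ∀ r < t, μ[|pathEvent Y n y] (T k ⁻¹' {(t : ℝ≥0∞)}) +
      ENNReal.ofReal (Real.exp (-(q * t))) ≤ ENNReal.ofReal (Real.exp (-(q * r))) := fun r hr => by
    rw [← h.cond_tail hQ hE k t, ← h.cond_tail hQ hE k r, ← measure_union]
    · refine measure_mono ?_
      rintro ω (hω | hω)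
      · rw [Set.mem_preimage, Set.mem_singleton_iff] at hω
        rw [Set.mem_preimage, hω, Set.mem_Ioi]; exact_mod_cast hr
      · rw [Set.mem_preimage, Set.mem_Ioi] at hω ⊢
        exact lt_trans (by exact_mod_cast hr) hω
    · refine Set.disjoint_left.2 fun ω hω hω' => ?_
      exact (ne_of_gt (Set.mem_Ioi.1 hω')) hω
    · exact h.measurable_hold k measurableSet_Ioi
  have hlim : Tendsto (fun r : ℝ≥0 => ENNReal.ofReal (Real.exp (-(q * r)))) (𝓝[<] t)
      (𝓝 (ENNReal.ofReal (Real.exp (-(q * t))))) := by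
    refine Tendsto.mono_left (Continuous.tendsto ?_ t) nhdsWithin_le_nhds
    exact ENNReal.continuous_ofReal.comp (by fun_prop)
  have : (𝓝[<] t).NeBot := nhdsLT_neBot_of_exists_lt ⟨0, pos_iff_ne_zero.2 ht⟩
  have hle := ge_of_tendsto hlim (eventually_nhdsWithin_of_forall hbound)
  refine le_antisymm (ENNReal.le_of_add_le_add_right
    (a := ENNReal.ofReal (Real.exp (-(q * t)))) ENNReal.ofReal_ne_top ?_) zero_le
  rwa [zero_add]

/-- An absorbing state is never left. -/
lemma cond_eq_top [IsProbabilityMeasure μ] (h : IsJumpHolding μ Q Y T)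
    (hQ : IsGenerator Q) {n : ℕ} {y : ℕ → ι} (hE : μ (pathEvent Y n y) ≠ 0) (k : Fin n)
    (hk : exitRate Q (y k) = 0) : ∀ᵐ ω ∂μ[|pathEvent Y n y], T k ω = ⊤ := by
  have : IsProbabilityMeasure (μ[|pathEvent Y n y]) := cond_isProbabilityMeasure hE
  have h1 : ∀ r : ℕ, ∀ᵐ ω ∂μ[|pathEvent Y n y], ((r : ℝ≥0) : ℝ≥0∞) < T k ω := fun r => by
    have := h.cond_tail hQ hE k r
    rw [hk] at this
    exact (mem_ae_iff_prob_eq_one (h.measurable_hold k measurableSet_Ioi)).2 (by simpa using this)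
  filter_upwards [ae_all_iff.2 h1] with ω hω
  by_contra htop
  obtain ⟨r, hr⟩ := ENNReal.exists_nat_gt htop
  exact lt_asymm hr (by exact_mod_cast hω r)

/-- The chain does not explode. -/
lemma ae_exists_one_lt_sum [IsProbabilityMeasure μ] (h : IsJumpHolding μ Q Y T)
    (hQ : IsGenerator Q) : ∀ᵐ ω ∂μ, ∃ n, 1 < ∑ k ∈ Finset.range n, T k ω := by
  set q := ∑ i, exitRate Q i
  set δ : ℝ≥0∞ := 1 - ENNReal.ofReal (Real.exp (-q))
  have hδ : δ < 1 := ENNReal.sub_lt_self ENNReal.one_ne_top one_ne_zero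
    (ENNReal.ofReal_pos.2 (Real.exp_pos _)).ne'
  -- `q` dominates every exit rate, so given the visited states each holding time is at most 1 with
  -- probability at most `δ < 1`, independently. Almost surely some holding time therefore exceeds
  -- 1.
  have key : ∀ n, μ {ω | ∀ k < n, T k ω ≤ 1} ≤ δ ^ n := fun n => by
    refine measure_le_of_pathEvent h.measurable_state n _ _ fun y => ?_
    rcases eq_or_ne (μ (pathEvent Y n y)) 0 with hE | hE
    · rw [measure_mono_null Set.inter_subset_left hE]; exact zero_le
    have : IsProbabilityMeasure (μ[|pathEvent Y n y]) := cond_isProbabilityMeasure hE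
    rw [← cond_mul_eq_inter (measurableSet_pathEvent h.measurable_state n y)]
    gcongr
    have hset : {ω | ∀ k < n, T k ω ≤ 1} = ⋂ k : Fin n, T k ⁻¹' Set.Iic 1 := by
      ext ω; simp [Fin.forall_iff]
    rw [hset, (h.cond_iIndepFun hQ hE).meas_iInter fun k => ⟨_, measurableSet_Iic, rfl⟩]
    calc _ ≤ ∏ _k : Fin n, δ := by
          refine Finset.prod_le_prod' fun k _ => ?_
          have hc : T k ⁻¹' Set.Iic 1 = (T k ⁻¹' Set.Ioi ((1 : ℝ≥0) : ℝ≥0∞))ᶜ := by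
            ext ω; simp
          rw [hc, prob_compl_eq_one_sub (h.measurable_hold k measurableSet_Ioi),
            h.cond_tail hQ hE]
          refine tsub_le_tsub_left (ENNReal.ofReal_le_ofReal (Real.exp_le_exp.2 (neg_le_neg ?_))) _
          rw [NNReal.coe_one, mul_one]
          exact Finset.single_le_sum (fun i _ => hQ.exitRate_nonneg i) (Finset.mem_univ _)
      _ = δ ^ n := by simp
  have hzero : μ {ω | ∀ k, T k ω ≤ 1} = 0 := by
    have hsub : ∀ n, {ω | ∀ k, T k ω ≤ 1} ⊆ {ω | ∀ k < n, T k ω ≤ 1} := fun n ω hω k _ => hω k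
    exact le_antisymm (ge_of_tendsto' (ENNReal.tendsto_pow_atTop_nhds_zero_of_lt_one hδ)
      fun n => (measure_mono (hsub n)).trans (key n)) zero_le
  filter_upwards [measure_eq_zero_iff_ae_notMem.1 hzero] with ω hω
  by_contra! hn
  refine hω fun k => le_trans ?_ (hn (k + 1))
  exact Finset.single_le_sum (f := fun k => T k ω) (fun _ _ => zero_le)
    (Finset.mem_range.2 k.lt_succ_self)

/-- The last holding time is independent of the others. By Fubini one may freeze those, and the
equation then leaves a single finite value for `T n`, which is not an atom. Finiteness is required
because `toReal` sends `⊤` to 0. -/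
lemma cond_linear_eq_null [IsProbabilityMeasure μ] (h : IsJumpHolding μ Q Y T)
    (hQ : IsGenerator Q) {n : ℕ} {y : ℕ → ι} (hE : μ (pathEvent Y (n + 1) y) ≠ 0)
    (d : Fin (n + 1) → ℝ) (hd : d (Fin.last n) ≠ 0) (c : ℝ) :
    μ[|pathEvent Y (n + 1) y] {ω | T n ω ≠ ⊤ ∧ ∑ k : Fin (n + 1), (T k ω).toReal * d k = c} = 0 := by
  have : IsProbabilityMeasure (μ[|pathEvent Y (n + 1) y]) := cond_isProbabilityMeasure hE
  set P := μ[|pathEvent Y (n + 1) y]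
  let S : Finset (Fin (n + 1)) := {Fin.last n}ᶜ
  have hind := (h.cond_iIndepFun hQ hE).indepFun_finset S {Fin.last n} disjoint_compl_left
    (fun k => h.measurable_hold k)
  let φ : (S → ℝ≥0∞) → ℝ := fun v => ∑ k : S, (v k).toReal * d k
  have hφ : Measurable φ := by fun_prop
  let ψ : (({Fin.last n} : Finset (Fin (n + 1))) → ℝ≥0∞) → ℝ≥0∞ :=
    fun u => u ⟨Fin.last n, Finset.mem_singleton_self _⟩
  have hψ : Measurable ψ := measurable_pi_apply _
  have hind' := hind.comp hφ hψ
  set V : Ω → ℝ := φ ∘ fun ω k => T k ω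
  have hU : (ψ ∘ fun ω (k : ({Fin.last n} : Finset (Fin (n + 1)))) => T k ω) = T n := by
    funext ω; simp [ψ]
  rw [hU] at hind'
  have hV : Measurable V := hφ.comp (measurable_pi_lambda _ fun k => h.measurable_hold k)
  have hprod := hind'.map_prod_eq_prod_map_map hV.aemeasurable (h.measurable_hold n).aemeasurable
  let D : Set (ℝ × ℝ≥0∞) := {p | p.2 ≠ ⊤ ∧ p.1 + p.2.toReal * d (Fin.last n) = c}
  have hD : MeasurableSet D := by
    refine MeasurableSet.inter ?_ ?_
    · exact (measurable_snd (measurableSet_singleton _)).compl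
    · exact measurableSet_eq_fun (by fun_prop) measurable_const
  have hpre : {ω | T n ω ≠ ⊤ ∧ ∑ k : Fin (n + 1), (T k ω).toReal * d k = c} =
      (fun ω => (V ω, T n ω)) ⁻¹' D := by
    ext ω
    have : ∑ k : Fin (n + 1), (T k ω).toReal * d k = V ω + (T n ω).toReal * d (Fin.last n) := by
      rw [← Finset.sum_compl_add_sum {Fin.last n}, Finset.sum_singleton, Fin.val_last]
      congr 1
      exact (Finset.sum_coe_sort S (fun k => (T k ω).toReal * d k)).symm
    simp only [Set.mem_ofPred_eq, Set.mem_preimage, D, this]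
  rw [hpre, ← Measure.map_apply (hV.prodMk (h.measurable_hold n)) hD, hprod,
    Measure.measure_prod_null hD]
  refine Eventually.of_forall fun v => ?_
  refine measure_mono_null (t := {((Real.toNNReal ((c - v) / d (Fin.last n)) : ℝ≥0) : ℝ≥0∞)}) ?_ ?_
  · rintro u ⟨hu, huv⟩
    simp only at hu huv
    rw [Set.mem_singleton_iff, ← huv, add_sub_cancel_left, mul_div_cancel_right₀ _ hd]
    exact (ENNReal.ofReal_toReal hu).symm
  · rw [Measure.map_apply (h.measurable_hold n) (measurableSet_singleton _)]
    exact h.cond_singleton hQ hE (Fin.last n) _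

/-- After at least one jump, the weighted occupation time has no atoms. -/
lemma ae_weighted_sum_ne [IsProbabilityMeasure μ] (h : IsJumpHolding μ Q Y T)
    (hQ : IsGenerator Q) {b : ι → ℝ} (hb : Function.Injective b) (c : ℝ) :
    ∀ᵐ ω ∂μ, ∀ n, T n ω ≠ ⊤ →
      ∑ k ∈ Finset.range (n + 1), (T k ω).toReal * (b (Y k ω) - b (Y (n + 1) ω)) +
        b (Y (n + 1) ω) ≠ c := by
  refine ae_all_iff.2 fun n => ?_
  rw [ae_iff]
  refine le_antisymm (measure_le_of_pathEvent h.measurable_state (n + 1) _ 0 fun y => ?_) zero_le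
  rw [zero_mul]
  rcases eq_or_ne (μ (pathEvent Y (n + 1) y)) 0 with hE | hE
  · exact (measure_mono_null Set.inter_subset_left hE).le
  have hJ : jumpMatrix Q (y n) (y (n + 1)) ≠ 0 := fun h0 => hE <| by
    rw [h.measure_pathEvent hQ, Finset.prod_range_succ, h0]; simp
  rw [← cond_mul_eq_inter (measurableSet_pathEvent h.measurable_state _ y)]
  have hcond : μ[|pathEvent Y (n + 1) y] {ω | T n ω ≠ ⊤ ∧
      ∑ k : Fin (n + 1), (T k ω).toReal * (b (y k) - b (y (n + 1))) = c - b (y (n + 1))} = 0 := by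
    -- On a path of positive probability a state is repeated only if it is absorbing, and then its
    -- holding time is infinite; otherwise the last coefficient is nonzero.
    by_cases hy : y n = y (n + 1)
    · have hq : exitRate Q (y n) = 0 := by
        by_contra hq; exact hJ (by rw [jumpMatrix, if_neg hq, if_pos hy])
      refine measure_mono_null ?_ (ae_iff.1 (h.cond_eq_top hQ hE (Fin.last n) hq))
      exact fun ω hω => hω.1
    · exact h.cond_linear_eq_null hQ hE (fun k => b (y k) - b (y (n + 1)))
        (sub_ne_zero.2 fun h => hy (hb h)) _
  have hae : ∀ᵐ ω ∂μ[|pathEvent Y (n + 1) y], ω ∈ pathEvent Y (n + 1) y :=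
    ae_cond_mem (measurableSet_pathEvent h.measurable_state _ y)
  rw [mul_eq_zero.2 (Or.inl ?_)]
  refine measure_mono_null_ae ?_ hcond
  filter_upwards [hae] with ω hω hB
  simp only [ne_eq, Classical.not_imp, not_not] at hB
  refine ⟨hB.1, ?_⟩
  rw [← hB.2, hω (n + 1) le_rfl, add_sub_cancel_right, Finset.sum_range]
  exact Finset.sum_congr rfl fun k _ => by rw [hω k (by omega)]

end IsJumpHolding

end

/-! ### Weighted occupation times of a Markov chain -/

section
variable {Ω ι : Type*} [MeasurableSpace Ω] {μ : Measure Ω} [Fintype ι] [DecidableEq ι]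
  [MeasurableSpace ι] [MeasurableSingletonClass ι] {Q : Matrix ι ι ℝ}
  {X : ℝ → Ω → ι}

lemma IsCTMC.measurable_weightedOccupation_sampled (hX : IsCTMC μ Q X) (b : ι → ℝ) {N : ℕ}
    (hN : 1 ≤ N) : Measurable (weightedOccupation b (sampled N X)) := by
  have : weightedOccupation b (sampled N X) = fun ω => (∑ n : Fin N, b (X ((n : ℝ) / N) ω)) / N :=
    funext fun ω => weightedOccupation_sampled b X ω hN
  rw [this]
  refine Measurable.div_const (Finset.measurable_sum _ fun n _ => ?_) _
  exact (measurable_of_countable b).comp (hX.measurable _ (by positivity))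

variable [IsProbabilityMeasure μ]

lemma IsCTMC.ae_isStepPath (hX : IsCTMC μ Q X) (hQ : IsGenerator Q) :
    ∀ᵐ ω ∂μ, ∃ y a n, IsStepPath (fun t => X t ω) y a n := by
  obtain ⟨Y, T, hJ, hpath⟩ := hX.jump_holding
  filter_upwards [hpath, hJ.ae_exists_one_lt_sum hQ] with ω hω ⟨n, hn⟩
  exact ⟨_, _, n, isStepPath_of_jump hω hn.le⟩

lemma IsCTMC.tendsto_weightedOccupation (hX : IsCTMC μ Q X) (hQ : IsGenerator Q) (b : ι → ℝ) :
    ∀ᵐ ω ∂μ, Tendsto (fun N => weightedOccupation b (sampled N X) ω) atTop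
      (𝓝 (weightedOccupation b X ω)) := by
  filter_upwards [hX.ae_isStepPath hQ] with ω ⟨y, a, n, h⟩
  exact tendsto_weightedOccupation_sampled b h

/-- `X` is only assumed measurable at each fixed time, so measurability comes from the sampled sums,
which converge almost surely. -/
lemma IsCTMC.aemeasurable_weightedOccupation (hX : IsCTMC μ Q X) (hQ : IsGenerator Q)
    (b : ι → ℝ) : AEMeasurable (weightedOccupation b X) μ := by
  refine aemeasurable_of_tendsto_metrizable_ae atTop (f := fun N : ℕ =>
    weightedOccupation b (sampled (N + 1) X))
    (fun N => (hX.measurable_weightedOccupation_sampled b N.succ_pos).aemeasurable) ?_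
  filter_upwards [hX.tendsto_weightedOccupation hQ b] with ω hω
  exact hω.comp (tendsto_add_atTop_nat 1)

/-- When the weights are distinct, a value of the weighted occupation time is almost surely
attained only by constant paths, for which sampling has no effect. -/
lemma IsCTMC.ae_weightedOccupation_sampled_eq (hX : IsCTMC μ Q X) (hQ : IsGenerator Q)
    {b : ι → ℝ} (hb : Function.Injective b) (c : ℝ) :
    ∀ᵐ ω ∂μ, weightedOccupation b X ω = c →
      ∀ N, 1 ≤ N → weightedOccupation b (sampled N X) ω = c := by
  obtain ⟨Y, T, hJ, hpath⟩ := hX.jump_holding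
  filter_upwards [hpath, hJ.ae_exists_one_lt_sum hQ, hJ.ae_weighted_sum_ne hQ hb c]
    with ω hω hex hne hc
  classical
  -- `m` is the number of jumps in `[0, 1]`.
  obtain ⟨m, hm⟩ : ∃ m, Nat.find hex = m + 1 := Nat.exists_eq_succ_of_ne_zero fun h0 => by
    have := Nat.find_spec hex; rw [h0] at this; simp at this
  have hlt : 1 < ∑ k ∈ Finset.range (m + 1), T k ω := hm ▸ Nat.find_spec hex
  have hle : ∑ k ∈ Finset.range m, T k ω ≤ 1 := not_lt.1 (Nat.find_min hex (by omega))
  have hW := weightedOccupation_eq_sum b (isStepPath_of_jump hω hlt.le)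
  have ha : ∀ k ≤ m, min (∑ k ∈ Finset.range k, T k ω) 1 = ∑ k ∈ Finset.range k, T k ω :=
    fun k hk => min_eq_left
      ((Finset.sum_le_sum_of_subset (Finset.range_mono hk)).trans hle)
  have hT : ∀ k < m, T k ω ≠ ⊤ := fun k hk => ne_top_of_le_ne_top ENNReal.one_ne_top
    ((Finset.single_le_sum (f := fun k => T k ω) (fun _ _ => zero_le)
      (Finset.mem_range.2 hk)).trans hle)
  have hsum : ∀ k ≤ m, (∑ k ∈ Finset.range k, T k ω).toReal =
      ∑ k ∈ Finset.range k, (T k ω).toReal := fun k hk =>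
    ENNReal.toReal_sum fun l hl => hT l ((Finset.mem_range.1 hl).trans_le hk)
  -- The last state `Y m` occupies the remaining time `1 - ∑ T k`, which produces the differences of
  -- weights.
  have hW' : weightedOccupation b X ω =
      ∑ k ∈ Finset.range m, (T k ω).toReal * (b (Y k ω) - b (Y m ω)) + b (Y m ω) := by
    rw [hW, Finset.sum_range_succ, min_eq_right hlt.le, ha m le_rfl, hsum m le_rfl]
    have : ∀ k ∈ Finset.range m, ((min (∑ k ∈ Finset.range (k + 1), T k ω) 1).toReal -
        (min (∑ k ∈ Finset.range k, T k ω) 1).toReal) * b (Y k ω) =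
        (T k ω).toReal * b (Y k ω) := fun k hk => by
      have hk := Finset.mem_range.1 hk
      rw [ha _ hk, ha _ hk.le, hsum _ hk, hsum _ hk.le, Finset.sum_range_succ, add_sub_cancel_left]
    rw [Finset.sum_congr rfl this, ENNReal.toReal_one]
    simp only [mul_sub, Finset.sum_sub_distrib, ← Finset.sum_mul]
    ring
  obtain _ | m := m
  · intro N hN
    have hN' : (0 : ℝ) < N := by exact_mod_cast hN
    rw [weightedOccupation_sampled b X ω hN, ← hc, hW']
    have : ∀ n : Fin N, X ((n : ℝ) / N) ω = Y 0 ω := fun n => by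
      have h1 : (n : ℝ) / N ≤ 1 := (div_le_one hN').2 (by exact_mod_cast n.2.le)
      refine hω _ (by positivity) 0 (by simp) (lt_of_le_of_lt ?_ hlt)
      rw [← ENNReal.ofReal_one]; exact ENNReal.ofReal_le_ofReal h1
    simp only [this]
    simp [hN'.ne']
  · exact absurd (hW'.symm.trans hc) (hne m (hT m m.lt_succ_self))

end

/-! ### Integration under fixed endpoints -/

/-- The law of the chain given the initial state `i`, restricted to the final state `j`. -/
noncomputable def endpointMeasure {Ω ι : Type*} [MeasurableSpace Ω] (μ : Measure Ω) (X : ℝ → Ω → ι) (i j : ι) :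
    Measure Ω :=
  (μ[|{ω | X 0 ω = i}]).restrict {ω | X 1 ω = j}

section
variable {Ω ι : Type*} [MeasurableSpace Ω] {μ : Measure Ω} {X : ℝ → Ω → ι} {i j : ι}

instance : IsFiniteMeasure (endpointMeasure μ X i j) := by
  unfold endpointMeasure; infer_instance

lemma endpointMeasure_absolutelyContinuous : endpointMeasure μ X i j ≪ μ :=
  Measure.absolutelyContinuous_of_le Measure.restrict_le_self |>.trans cond_absolutelyContinuous

lemma occupationLaw_eq_map [Fintype ι] [DecidableEq ι] (b : ι → ℝ) :
    occupationLaw μ b X i j = (endpointMeasure μ X i j).map (weightedOccupation b X) := rfl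

lemma occupationLaw_sampled [Fintype ι] [DecidableEq ι] (b : ι → ℝ) {N : ℕ} (hN : 1 ≤ N) :
    occupationLaw μ b (sampled N X) i j =
      (endpointMeasure μ X i j).map (weightedOccupation b (sampled N X)) := by
  rw [occupationLaw, sampled_zero, sampled_one hN, endpointMeasure]

lemma setIntegral_map_of_ae_mem {ν : Measure Ω} {W : Ω → ℝ} (hW : AEMeasurable W ν) {I : Set ℝ}
    (hI : MeasurableSet I) (hWI : ∀ᵐ ω ∂ν, W ω ∈ I) {f : ℝ → ℝ} (hf : Measurable f) :
    ∫ w in I, f w ∂(ν.map W) = ∫ ω, f (W ω) ∂ν := by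
  rw [Measure.restrict_eq_self_of_ae_mem ((ae_map_iff hW hI).2 hWI),
    integral_map hW hf.aestronglyMeasurable]

/-- Integration of a function of the sampled path. -/
lemma integral_sampled_path [Fintype ι] [DecidableEq ι] [MeasurableSpace ι]
    [MeasurableSingletonClass ι] (hX : ∀ t, 0 ≤ t → Measurable (X t)) {N : ℕ} (hN : 1 ≤ N)
    (f : (Fin (N + 1) → ι) → ℝ) :
    ∫ ω, f (fun n => X ((n : ℝ) / N) ω) ∂(endpointMeasure μ X i j) =
      ∑ s : Fin (N + 1) → ι with s (Fin.last N) = j,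
        (μ[|{ω | X 0 ω = i}]).real {ω | ∀ n : Fin (N + 1), X ((n : ℝ) / N) ω = s n} * f s := by
  have hN' : (N : ℝ) ≠ 0 := by positivity
  set p : Ω → Fin (N + 1) → ι := fun ω n => X ((n : ℝ) / N) ω
  have hp : Measurable p := measurable_pi_lambda _ fun n => hX _ (by positivity)
  have hset : ∀ s, {ω | ∀ n : Fin (N + 1), X ((n : ℝ) / N) ω = s n} = p ⁻¹' {s} := fun s => by
    ext ω; simp [p, funext_iff]
  have hlast : ∀ ω, p ω (Fin.last N) = X 1 ω := fun ω => by simp [p, hN']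
  rw [← integral_map (φ := p) hp.aemeasurable (measurable_of_countable f).aestronglyMeasurable,
    integral_fintype Integrable.of_finite, Finset.sum_filter]
  refine Finset.sum_congr rfl fun s _ => ?_
  rw [map_measureReal_apply hp (measurableSet_singleton s), endpointMeasure,
    measureReal_restrict_apply (hp (measurableSet_singleton s)), hset, smul_eq_mul]
  split_ifs with hs
  · congr 2
    refine Set.inter_eq_left.2 fun ω hω => ?_
    have hω : p ω = s := hω
    change X 1 ω = j
    rw [← hlast, hω, hs]
  · have : p ⁻¹' {s} ∩ {ω | X 1 ω = j} = ∅ := by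
      refine Set.eq_empty_of_forall_notMem ?_
      rintro ω ⟨hω, hω'⟩
      have hω : p ω = s := hω
      have hω' : X 1 ω = j := hω'
      exact hs (by rw [← hω, hlast, hω'])
    rw [this]; simp

end

end RareTransition

/-! ### The bound and its limits -/

open RareTransition
theorem mainTheorem4 {Ω : Type*} [MeasurableSpace Ω] (μ : Measure Ω) [IsProbabilityMeasure μ]
    -- the channel has `m + 1` states, with generator `Q` and crossover probabilities `ε`
    (m : ℕ) (Q : Matrix (Fin (m + 1)) (Fin (m + 1)) ℝ) (hQ : IsGenerator Q)
    (X : ℝ → Ω → Fin (m + 1)) (hX : IsCTMC μ Q X)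
    (ε : Fin (m + 1) → ℝ) (hε : StrictMono ε) (hε0 : ∀ s, 0 ≤ ε s) (hε2 : ∀ s, ε s ≤ 1 / 2)
    (ρ : ℝ) (hρ0 : 0 ≤ ρ) (hρ1 : ρ ≤ 1) (R : ℝ)
    (i j : Fin (m + 1)) (hi : μ {ω | X 0 ω = i} ≠ 0)
    (b : Fin (m + 1) → ℝ) (hb : ∀ s, b s = bscExponent (ε s) ρ)
    (I : Set ℝ) (hI : I = Set.Icc (b (Fin.last m)) (b 0))
    (GN : ℕ → Measure ℝ) (hGN : ∀ N, GN N = occupationLaw μ b (sampled N X) i j)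
    (G : Measure ℝ) (hG : G = occupationLaw μ b X i j) :
    -- the upper bound at every block length
    (∀ N : ℕ, 1 ≤ N → ∀ M : ℕ, (M : ℝ) < Real.exp (N * R) + 1 →
      ∀ dec : Decoder (Fin (m + 1)) M N, IsMaximumLikelihood ε dec → ∀ k : Fin M,
        jointErrorProb μ X ε dec k i j ≤ ∫ w in I, boundFun N ρ R w ∂(GN N)) ∧
    -- the limit of this bound
    Tendsto (fun N : ℕ => ∫ w in I, boundFun N ρ R w ∂(GN N)) atTop
      (𝓝 (∫ w in I, (Set.Iic (ρ * R)).indicator (fun _ => (1 : ℝ)) w ∂G)) ∧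
    -- the approximate bound, in terms of the limiting law, has the same limit
    Tendsto (fun N : ℕ => ∫ w in I, boundFun N ρ R w ∂G) atTop
      (𝓝 (∫ w in I, (Set.Iic (ρ * R)).indicator (fun _ => (1 : ℝ)) w ∂G)) ∧
    -- so it is an upper bound up to an error that vanishes as the block length grows
    (∀ δ : ℝ, 0 < δ → ∃ N₀ : ℕ, ∀ N : ℕ, N₀ ≤ N → ∀ M : ℕ, (M : ℝ) < Real.exp (N * R) + 1 →
      ∀ dec : Decoder (Fin (m + 1)) M N, IsMaximumLikelihood ε dec → ∀ k : Fin M,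
        jointErrorProb μ X ε dec k i j ≤ (∫ w in I, boundFun N ρ R w ∂G) + δ) := by

  have hε1 : ∀ s, ε s < 1 := fun s => (hε2 s).trans_lt (by norm_num)
  have hb' : b = fun s => bscExponent (ε s) ρ := funext hb
  -- All weights lie in `I`, so restricting the integrals to `I` loses no mass. For `ρ = 0` every
  -- weight is 0.
  have hanti : ∀ s, b s ∈ I := by
    intro s
    rw [hI]
    rcases hρ0.eq_or_lt with rfl | hρ
    · simp [hb, bscExponent_zero]
    · have hmem : ∀ s, ε s ∈ Set.Icc (0 : ℝ) (1 / 2) := fun s => ⟨hε0 s, hε2 s⟩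
      simp only [hb]
      exact ⟨(strictAntiOn_bscExponent hρ).antitoneOn (hmem _) (hmem _) (hε.monotone (Fin.le_last s)),
        (strictAntiOn_bscExponent hρ).antitoneOn (hmem _) (hmem _) (hε.monotone (Fin.zero_le s))⟩
  have hconst : ∀ᵐ ω ∂μ, weightedOccupation b X ω = ρ * R →
      ∀ N, 1 ≤ N → weightedOccupation b (sampled N X) ω = ρ * R := by
    -- For `ρ = 0` the weights are not distinct in general, but then every `W_N` equals `0 = ρ R`.
    rcases hρ0.eq_or_lt with rfl | hρ
    · refine Eventually.of_forall fun ω _ N _ => ?_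
      simp [weightedOccupation, hb, bscExponent_zero]
    · refine hX.ae_weightedOccupation_sampled_eq hQ ?_ _
      rw [hb']
      exact fun s s' h => hε.injective ((strictAntiOn_bscExponent hρ).injOn
        ⟨hε0 s, hε2 s⟩ ⟨hε0 s', hε2 s'⟩ h)
  have hIm : MeasurableSet I := hI ▸ measurableSet_Icc
  have hIc : IsClosed I := hI ▸ isClosed_Icc
  have hν := endpointMeasure_absolutelyContinuous (μ := μ) (X := X) (i := i) (j := j)
  have hWN : ∀ N, 1 ≤ N → ∀ ω, weightedOccupation b (sampled N X) ω ∈ I := fun N hN ω => by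
    rw [hI] at hanti ⊢
    exact weightedOccupation_sampled_mem hanti ω hN
  have hlim := hX.tendsto_weightedOccupation hQ b
  have hW : ∀ᵐ ω ∂μ, weightedOccupation b X ω ∈ I := by
    filter_upwards [hlim] with ω hω
    exact hIc.mem_of_tendsto hω (eventually_atTop.2 ⟨1, fun N hN => hWN N hN ω⟩)
  have intN : ∀ N, 1 ≤ N → ∫ w in I, boundFun N ρ R w ∂(GN N) =
      ∫ ω, boundFun N ρ R (weightedOccupation b (sampled N X) ω) ∂(endpointMeasure μ X i j) :=
    fun N hN => by
      rw [hGN, occupationLaw_sampled b hN]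
      exact setIntegral_map_of_ae_mem
        (hX.measurable_weightedOccupation_sampled b hN).aemeasurable hIm
        (Eventually.of_forall (hWN N hN)) (measurable_boundFun N ρ R)
  have hind : Measurable ((Set.Iic (ρ * R)).indicator (fun _ => (1 : ℝ))) :=
    measurable_const.indicator measurableSet_Iic
  have part1 : ∀ N : ℕ, 1 ≤ N → ∀ M : ℕ, (M : ℝ) < Real.exp (N * R) + 1 →
      ∀ dec : Decoder (Fin (m + 1)) M N, IsMaximumLikelihood ε dec → ∀ k : Fin M,
        jointErrorProb μ X ε dec k i j ≤ ∫ w in I, boundFun N ρ R w ∂(GN N) := by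
    intro N hN M hM dec hdec k
    rw [intN N hN]
    simp only [weightedOccupation_sampled b X _ hN]
    refine le_of_le_of_eq ?_ (integral_sampled_path hX.measurable hN
      (fun s => boundFun N ρ R ((∑ n : Fin N, b (s n.castSucc)) / N))).symm
    refine Finset.sum_le_sum fun s _ => mul_le_mul_of_nonneg_left ?_ measureReal_nonneg
    rw [hb']
    exact errorGivenStates_le_boundFun hε0 hε1 hN hM hdec k s hρ0 hρ1
  have part2 : Tendsto (fun N : ℕ => ∫ w in I, boundFun N ρ R w ∂(GN N)) atTop
      (𝓝 (∫ w in I, (Set.Iic (ρ * R)).indicator (fun _ => (1 : ℝ)) w ∂G)) := by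
    rw [hG, occupationLaw_eq_map, setIntegral_map_of_ae_mem
      ((hX.aemeasurable_weightedOccupation hQ b).mono_ac hν) hIm (hν.ae_le hW) hind]
    refine Tendsto.congr' (f₁ := fun N : ℕ => ∫ ω, boundFun N ρ R
      (weightedOccupation b (sampled N X) ω) ∂(endpointMeasure μ X i j)) ?_ ?_
    · filter_upwards [eventually_ge_atTop 1] with N hN using (intN N hN).symm
    refine tendsto_integral_filter_of_dominated_convergence (fun _ => 1) ?_ ?_
      (integrable_const _) ?_
    · filter_upwards [eventually_ge_atTop 1] with N hN
      exact ((measurable_boundFun N ρ R).comp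
        (hX.measurable_weightedOccupation_sampled b hN)).aestronglyMeasurable
    · exact Eventually.of_forall fun N => Eventually.of_forall fun ω => norm_boundFun_le _ _ _ _
    -- `hconst` settles the discontinuity: where `W = ρ R`, the sampled values already equal it.
    · filter_upwards [hν.ae_le hlim, hν.ae_le hconst] with ω hω hω'
      refine tendsto_boundFun hω fun h => ?_
      filter_upwards [eventually_ge_atTop 1] with N hN
      rw [hω' h N hN, h]
  have part3 : Tendsto (fun N : ℕ => ∫ w in I, boundFun N ρ R w ∂G) atTop
      (𝓝 (∫ w in I, (Set.Iic (ρ * R)).indicator (fun _ => (1 : ℝ)) w ∂G)) := by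
    have : IsFiniteMeasure G := by rw [hG, occupationLaw_eq_map]; infer_instance
    refine tendsto_integral_filter_of_dominated_convergence (fun _ => 1) ?_ ?_
      (integrable_const _) ?_
    · exact Eventually.of_forall fun N => (measurable_boundFun N ρ R).aestronglyMeasurable
    · exact Eventually.of_forall fun N => Eventually.of_forall fun w => norm_boundFun_le _ _ _ _
    · exact Eventually.of_forall fun w =>
        tendsto_boundFun tendsto_const_nhds fun _ => Eventually.of_forall fun _ => rfl
  refine ⟨part1, part2, part3, fun δ hδ => ?_⟩
  have hsub := part2.sub part3
  rw [sub_self] at hsub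
  obtain ⟨N₀, hN₀⟩ := eventually_atTop.1 (hsub.eventually_lt_const hδ)
  -- The bound of the first part requires `N ≥ 1`.
  refine ⟨max N₀ 1, fun N hN M hM dec hdec k => ?_⟩
  have h1 := part1 N ((le_max_right _ _).trans hN) M hM dec hdec k
  have h2 := hN₀ N ((le_max_left _ _).trans hN)
  linarith
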